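/- Metrics. Equip the open half-sphere $\{(r,z,t)\in\mathbb R^3: r^2+z^2+t^2=1,\ r>0\}$, the space of principal orbits of the rotation of the first two coordinates on $\mathbb S^3\subset\mathbb R^4$, with the metric $4\pi^2\sin^2\nu\,(d\nu^2+\cos^2\nu\,d\lambda^2)$, where $r=\sin\nu$, $z=\cos\nu\cos\lambda$, $t=\cos\nu\sin\lambda$. Equip $\mathbb S^2\setminus\{N,S\}$ with the metric $\tilde g_1=4\pi^2\cos^2\varphi\,(d\varphi^2+\cos^2\varphi\,d\theta^2)$, where $\varphi\in(-\frac\pi2,\frac\pi2)$ is the latitude and $\theta$ the longitude. Bipolar surfaces. Let $p,q$ be coprime positive integers with $\frac12<\frac pq<\frac{\sqrt2}2$. An Otsuki torus $O_{p/q}$ (unique up to rotation) is the torus $$I(\alpha,s)=(\cos\alpha\sin\nu(s),\ \sin\alpha\sin\nu(s),\ \cos\nu(s)\cos\lambda(s),\ \cos\nu(s)\sin\lambda(s))\in\mathbb S^3$$ over a closed unit-speed geodesic $(\nu(s),\lambda(s))$ of the first metric with $0<\nu<\frac\pi2$, whose minimal value $a=\min\nu\in(0,\frac\pi4)$ satisfies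 $$\sin a\cos a\int_a^{\frac\pi2-a}\frac{d\nu}{\cos\nu\sqrt{\sin^2\nu\cos^2\nu-\sin^2a\cos^2a}}=\frac pq\pi .$$ Let $I^*$ be a continuous unit normal field of $I$ in $\mathbb S^3$. The bipolar surface $\tilde O_{p/q}$ is the surface $I\wedge I^*$ in $\Lambda^2\mathbb R^4=\mathbb R^6$. It lies in the equatorial $\mathbb S^4\subset\mathbb R^5=\{e_{12}=0\}$, on which the coordinates are $(x,y,z,u,v)=(e_{13},e_{23},e_{14},e_{24},e_{34})$. Invariant surfaces. Let $SO(2)$ act on $\mathbb S^4$ by rotating the planes $(x,y)$ and $(z,u)$ by the same angle. Let $\tilde\pi$ be the projection of $\mathbb S^4\setminus\{(0,0,0,0,\pm1)\}$ onto the space of orbits, and let $p$ be the restriction of $\tilde\pi$ to the sphere $\mathbb S^2=\{(\cos\varphi\sin\theta,0,\cos\varphi\cos\theta,0,\sin\varphi)\}$ without its poles $N,S$. Proposition 3. For every closed geodesic $\gamma=(\varphi(t),\theta(t))$ of $(\mathbb S^2\setminus\{N,S\},\tilde g_1)$, parametrized by arc length, the set $\tilde\pi^{-1}(p(\gamma))$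 is a minimal surface in $\mathbb S^4$, immersed by $$J(\alpha,t)=(\cos\alpha\cos\varphi\sin\theta,\ \sin\alpha\cos\varphi\sin\theta,\ \cos\alpha\cos\varphi\cos\theta,\ \sin\alpha\cos\varphi\cos\theta,\ \sin\varphi).$$ The set of all bipolar surfaces $\tilde O_{p/q}$ (for all $p/q$ as above, all geodesics $(\nu,\lambda)$ and both choices of $I^*$) coincides with the set of all surfaces $\tilde\pi^{-1}(p(\gamma))$, where $\gamma$ is a closed geodesic of $(\mathbb S^2\setminus\{N,S\},\tilde g_1)$ other than the equator $\varphi\equiv0$. They coincide also as immersed surfaces: for every such $I\wedge I^*$ there is such a $\gamma$, and for every such $\gamma$ there is such an $I\wedge I^*$, with $(I\wedge I^*)(\alpha,\tau(t))=J(\alpha,t)$ for all $\alpha,t\in\mathbb R$, where $\tau$ is an increasing diffeomorphism of $\mathbb R$. Whenever $\tilde\pi^{-1}(p(\gamma))$ is the bipolar surface of an Otsuki torus with minimal value $a$ of $\nu$, the minimal value $b$ of $\varphi$ on $\gamma$ satisfies $\cos^4b=4\sin^2a\cos^2a$. -/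

import Mathlib

open scoped ContDiff

noncomputable section

namespace Otsuki

/-! ### Geodesics and minimal immersions -/

/-- `t ↦ (u t, v t)` is a unit-speed geodesic, defined for all times, of the metric
`E(u) du² + G(u) dv²`. The Christoffel symbols are
`Γᵘᵤᵤ = E'/(2E)`, `Γᵘᵥᵥ = -G'/(2E)`, `Γᵛᵤᵥ = G'/(2G)`; the other ones vanish. -/
structure IsUnitSpeedGeodesic (E G : ℝ → ℝ) (u v : ℝ → ℝ) : Prop where
  smooth_u : ContDiff ℝ ∞ u
  smooth_v : ContDiff ℝ ∞ v
  eq_u : ∀ t, deriv (deriv u) t + deriv E (u t) / (2 * E (u t)) * deriv u t ^ 2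
    - deriv G (u t) / (2 * E (u t)) * deriv v t ^ 2 = 0
  eq_v : ∀ t, deriv (deriv v) t + deriv G (u t) / G (u t) * deriv u t * deriv v t = 0
  unit_speed : ∀ t, E (u t) * deriv u t ^ 2 + G (u t) * deriv v t ^ 2 = 1

/-- The curve closes up; `v` is an angle, i.e. a coordinate modulo `2π`. -/
def IsClosedCurve (u v : ℝ → ℝ) : Prop :=
  ∃ T > 0, ∃ k : ℤ, ∀ t, u (t + T) = u t ∧ v (t + T) = v t + 2 * Real.pi * k

/-- The parametrized surface `X` is a minimal immersion into the unit sphere of `ℝⁿ`: it is a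
smooth immersion with values in the sphere, and the trace of its second fundamental form as a
surface in the sphere (multiplied by `EG - F²`) vanishes in every normal direction. -/
structure IsMinimalImmersionInSphere {n : ℕ} (X : ℝ → ℝ → EuclideanSpace ℝ (Fin n)) : Prop where
  smooth : ContDiff ℝ ∞ (fun z : ℝ × ℝ => X z.1 z.2)
  mem_sphere : ∀ α t, ‖X α t‖ = 1
  immersion : ∀ α t,
    LinearIndependent ℝ ![deriv (fun β => X β t) α, deriv (fun s => X α s) t]
  mean_curvature_zero : ∀ α t, ∀ w : EuclideanSpace ℝ (Fin n),
    inner ℝ w (X α t) = 0 →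
    inner ℝ w (deriv (fun β => X β t) α) = 0 →
    inner ℝ w (deriv (fun s => X α s) t) = 0 →
    ‖deriv (fun s => X α s) t‖ ^ 2 * inner ℝ w (deriv (deriv (fun β => X β t)) α)
      - 2 * inner ℝ (deriv (fun β => X β t) α) (deriv (fun s => X α s) t)
          * inner ℝ w (deriv (fun s => deriv (fun β => X β s) α) t)
      + ‖deriv (fun β => X β t) α‖ ^ 2 * inner ℝ w (deriv (deriv (fun s => X α s)) t) = 0

/-! ### Otsuki tori in `S³` -/

/-- The rotation torus in `S³` over the curve `(ν, lam)` in the orbit space of the rotation of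
the first two coordinates of `ℝ⁴`. -/
def rotationTorus (nu lam : ℝ → ℝ) (α t : ℝ) : EuclideanSpace ℝ (Fin 4) :=
  !₂[Real.cos α * Real.sin (nu t), Real.sin α * Real.sin (nu t),
    Real.cos (nu t) * Real.cos (lam t), Real.cos (nu t) * Real.sin (lam t)]

/-- The function `Ω(a)`: the increment of `lam` along the geodesic between a minimum `ν = a` and
the next maximum `ν = π/2 - a`. The integrand is improper, but integrable. -/
def Omega (a : ℝ) : ℝ :=
  Real.sin a * Real.cos a * ∫ x in a..(Real.pi / 2 - a),
    1 / (Real.cos x * Real.sqrt (Real.sin x ^ 2 * Real.cos x ^ 2 - Real.sin a ^ 2 * Real.cos a ^ 2))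

/-- `(ν, lam)` is a closed geodesic in the space of principal orbits of `S³`, with the metric
`4π² sin² ν (dν² + cos² ν dlam²)`, whose rotation torus is an Otsuki torus `O_{p/q}`; the number
`a` is the minimum of `ν`. -/
structure IsOtsukiGeodesic (p q : ℕ) (a : ℝ) (nu lam : ℝ → ℝ) : Prop where
  p_pos : 0 < p
  q_pos : 0 < q
  coprime : Nat.Coprime p q
  lower : (1 : ℝ) / 2 < (p : ℝ) / q
  upper : (p : ℝ) / q < Real.sqrt 2 / 2
  a_mem : a ∈ Set.Ioo 0 (Real.pi / 4)
  nu_mem : ∀ t, nu t ∈ Set.Ioo 0 (Real.pi / 2)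
  geodesic : IsUnitSpeedGeodesic (fun x => 4 * Real.pi ^ 2 * Real.sin x ^ 2)
    (fun x => 4 * Real.pi ^ 2 * Real.sin x ^ 2 * Real.cos x ^ 2) nu lam
  closed : IsClosedCurve nu lam
  isLeast : IsLeast (Set.range nu) a
  omega : Omega a = (p : ℝ) / q * Real.pi

/-! ### Bipolar surfaces -/

/-- `I'` is a continuous unit normal field along the surface `I` in `S³`, tangent to `S³`. -/
structure IsUnitNormal (I I' : ℝ → ℝ → EuclideanSpace ℝ (Fin 4)) : Prop where
  continuous : Continuous (fun z : ℝ × ℝ => I' z.1 z.2)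
  norm_eq_one : ∀ α t, ‖I' α t‖ = 1
  tangent : ∀ α t, inner ℝ (I' α t) (I α t) = 0
  normal_left : ∀ α t, inner ℝ (I' α t) (deriv (fun β => I β t) α) = 0
  normal_right : ∀ α t, inner ℝ (I' α t) (deriv (fun s => I α s) t) = 0

/-- The exterior product of two vectors of `ℝ⁴`, in the coordinates of `Λ²ℝ⁴ = ℝ⁶` given by
the basis `e₁₂, e₁₃, e₁₄, e₂₃, e₂₄, e₃₄`. -/
def wedge (w w' : EuclideanSpace ℝ (Fin 4)) : EuclideanSpace ℝ (Fin 6) :=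
  !₂[w 0 * w' 1 - w 1 * w' 0, w 0 * w' 2 - w 2 * w' 0, w 0 * w' 3 - w 3 * w' 0,
    w 1 * w' 2 - w 2 * w' 1, w 1 * w' 3 - w 3 * w' 1, w 2 * w' 3 - w 3 * w' 2]

/-- The embedding of `ℝ⁵`, with coordinates `(x, y, z, u, v)`, into `Λ²ℝ⁴` as the hyperplane on
which the `e₁₂`-coordinate is zero:
`x = e₁₃`, `y = e₂₃`, `z = e₁₄`, `u = e₂₄`, `v = e₃₄`. It maps `S⁴` onto an equator of `S⁵`. -/
def equator (X : EuclideanSpace ℝ (Fin 5)) : EuclideanSpace ℝ (Fin 6) :=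
  !₂[0, X 0, X 2, X 1, X 3, X 4]

/-- `S ⊆ ℝ⁵` is, as a subset, a bipolar surface `Õ_{p/q}`: the surface `I ∧ I'`, where `I` is an
Otsuki torus `O_{p/q}` and `I'` is a unit normal field of it. -/
def IsBipolarOtsukiSurface (p q : ℕ) (S : Set (EuclideanSpace ℝ (Fin 5))) : Prop :=
  ∃ (a : ℝ) (nu lam : ℝ → ℝ) (I' : ℝ → ℝ → EuclideanSpace ℝ (Fin 4)),
    IsOtsukiGeodesic p q a nu lam ∧ IsUnitNormal (rotationTorus nu lam) I' ∧
      equator '' S = Set.range (fun z : ℝ × ℝ => wedge (rotationTorus nu lam z.1 z.2) (I' z.1 z.2))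

/-! ### Rotation invariant surfaces in `S⁴` -/

/-- The action of `SO(2)` on `ℝ⁵`. -/
def rot (α : ℝ) (X : EuclideanSpace ℝ (Fin 5)) : EuclideanSpace ℝ (Fin 5) :=
  !₂[Real.cos α * X 0 - Real.sin α * X 1, Real.sin α * X 0 + Real.cos α * X 1,
    Real.cos α * X 2 - Real.sin α * X 3, Real.sin α * X 2 + Real.cos α * X 3, X 4]

/-- The orbit of a point. The orbit space is the set of orbits, and this is the projection. -/
def orbit (X : EuclideanSpace ℝ (Fin 5)) : Set (EuclideanSpace ℝ (Fin 5)) :=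
  Set.range (fun α => rot α X)

/-- The union of the principal orbits in `S⁴`: the sphere without its two poles. -/
def principalPart : Set (EuclideanSpace ℝ (Fin 5)) :=
  {X | ‖X‖ = 1 ∧ X ≠ !₂[0, 0, 0, 0, 1] ∧ X ≠ !₂[0, 0, 0, 0, -1]}

/-- The point with spherical coordinates `(φ, θ)` of the sphere `S² ⊆ S⁴` given by
`y = u = 0`. -/
def point (phi theta : ℝ) : EuclideanSpace ℝ (Fin 5) :=
  !₂[Real.cos phi * Real.sin theta, 0, Real.cos phi * Real.cos theta, 0, Real.sin phi]

/-- `(φ, θ)` is a closed geodesic of `S²` without poles, with the metric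
`4π² cos² φ (dφ² + cos² φ dθ²)`. -/
structure IsClosedGeodesic (phi theta : ℝ → ℝ) : Prop where
  phi_mem : ∀ t, phi t ∈ Set.Ioo (-(Real.pi / 2)) (Real.pi / 2)
  geodesic : IsUnitSpeedGeodesic (fun x => 4 * Real.pi ^ 2 * Real.cos x ^ 2)
    (fun x => 4 * Real.pi ^ 2 * Real.cos x ^ 2 * Real.cos x ^ 2) phi theta
  closed : IsClosedCurve phi theta

/-- The preimage in `S⁴` without poles of the image in the orbit space of the curve
`(φ, θ)` in `S²`. -/
def orbitSurface (phi theta : ℝ → ℝ) : Set (EuclideanSpace ℝ (Fin 5)) :=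
  {X | X ∈ principalPart ∧ orbit X ∈ orbit '' Set.range (fun t => point (phi t) (theta t))}

/-- The standard parametrization of `orbitSurface phi theta`. -/
def orbitImmersion (phi theta : ℝ → ℝ) (α t : ℝ) : EuclideanSpace ℝ (Fin 5) :=
  !₂[Real.cos α * Real.cos (phi t) * Real.sin (theta t),
    Real.sin α * Real.cos (phi t) * Real.sin (theta t),
    Real.cos α * Real.cos (phi t) * Real.cos (theta t),
    Real.sin α * Real.cos (phi t) * Real.cos (theta t), Real.sin (phi t)]

/-- The immersed surface `I ∧ I'`, where `I` is the rotation torus over `(nu, lam)`, is the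
surface `orbitImmersion phi theta` in the equator, up to a smooth change of the parameter `t`. -/
def SameImmersion (nu lam : ℝ → ℝ) (I' : ℝ → ℝ → EuclideanSpace ℝ (Fin 4))
    (phi theta : ℝ → ℝ) : Prop :=
  ∃ τ : ℝ → ℝ, ContDiff ℝ ∞ τ ∧ (∀ t, 0 < deriv τ t) ∧ Function.Surjective τ ∧
    ∀ α t, wedge (rotationTorus nu lam α (τ t)) (I' α (τ t))
      = equator (orbitImmersion phi theta α t)

end Otsuki

end

namespace Otsuki

/-! ### First integrals of the two geodesic flows -/

/-! Clairaut's relation and the unit speed condition integrate both geodesic flows. In the variables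
z = sin² ν and y = sin φ the flows become the rational systems `ToricSystem c` and `DualSystem k`,
and the theorem is an explicit duality between these systems with k = -2c.

The duality is read off from I ∧ I*. Let (f, g) be the unit tangent of the curve (ν, λ) in the round
sphere. A unit normal of the torus is ε times the quarter turn of (f, g), with a constant sign ε.
The e₃₄-coordinate of I ∧ I* is ε f cos ν = επz', so y = επz'. The other coordinates are a rotation
by α of a plane vector which, written as cos φ (cos θ + i sin θ), equals ε (f sin ν + i g) exp(-iλ);
this determines θ. The energy equation reads 1 - y² = z + c²/z, and in the new time dt = (1 + c²/z²)
ds the pair (y, θ) solves the dual system (`ToricSystem.dualSystem`, `wedge_torusNormal_eq`). For ε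
= 1 the inverse is z = (1 - y²)(1 - 2πy')/2, ds = (1 - 2πy')/2 dt (`DualSystem.toricSystem`). The
time changes t = 2s + 2π²z' and s = (t - 2πy)/2 are explicit and differ from linear maps by bounded
periodic terms, so closed geodesics go to closed geodesics.

In the direction from S² to S³ it remains to recognize an Otsuki torus. A closed geodesic has k ≠ 0,
and k² < 1 unless it is the equator, so sin 2a = |k| defines a. Closedness makes Ω(a)/π rational
(`ToricSystem.exists_Omega_eq`). The bounds 1/2 < Ω(a)/π < √2/2 hold for every a (`Omega_mem`): with
cos 2ν = cos 2a cos x, symmetrizing in x ↦ π - x leaves the factor sin ν + cos ν, which lies between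
1 and √2, against an integral that is elementary.

At the minima the energy equations give c² = sin² a cos² a and cos⁴ b = k² = 4c². Minimality of J is
a direct consequence of the geodesic equations: the area of J over an arc is its length for the
metric of S². -/

/-- The equations satisfied by `z = sin² ν`, its derivative `z₁` and the angle `lam` along a
geodesic `(ν, lam)` of `4π² sin² ν (dν² + cos² ν dlam²)` with Clairaut constant `2πc`. -/
structure ToricSystem (c : ℝ) (z z₁ lam : ℝ → ℝ) : Prop where
  pos : ∀ t, 0 < z t
  lt_one : ∀ t, z t < 1
  hasDerivAt : ∀ t, HasDerivAt z (z₁ t) t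
  hasDerivAt' : ∀ t, HasDerivAt z₁ ((-1 + c ^ 2 / z t ^ 2) / (2 * Real.pi ^ 2)) t
  energy : ∀ t, Real.pi ^ 2 * z₁ t ^ 2 = 1 - z t - c ^ 2 / z t
  hasDerivAt_angle : ∀ t, HasDerivAt lam (c / (2 * Real.pi * z t * (1 - z t))) t

/-- The equations satisfied by `y = sin φ`, its derivative `y₁` and the angle `theta` along a
geodesic `(φ, theta)` of `4π² cos² φ (dφ² + cos² φ dtheta²)` with Clairaut constant `2πk`. -/
structure DualSystem (k : ℝ) (y y₁ theta : ℝ → ℝ) : Prop where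
  sq_lt_one : ∀ t, y t ^ 2 < 1
  hasDerivAt : ∀ t, HasDerivAt y (y₁ t) t
  hasDerivAt' : ∀ t,
    HasDerivAt y₁ (-k ^ 2 * y t / (2 * Real.pi ^ 2 * (1 - y t ^ 2) ^ 3)) t
  energy : ∀ t, 4 * Real.pi ^ 2 * y₁ t ^ 2 = 1 - k ^ 2 / (1 - y t ^ 2) ^ 2
  hasDerivAt_angle : ∀ t, HasDerivAt theta (k / (2 * Real.pi * (1 - y t ^ 2) ^ 2)) t

lemma hasDerivAt_sinSq (x : ℝ) :
    HasDerivAt (fun x => 4 * Real.pi ^ 2 * Real.sin x ^ 2)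
      (8 * Real.pi ^ 2 * Real.sin x * Real.cos x) x := by
  refine (((Real.hasDerivAt_sin x).pow 2).const_mul (4 * Real.pi ^ 2)).congr_deriv ?_
  push_cast; ring

lemma hasDerivAt_sinSq_mul_cosSq (x : ℝ) :
    HasDerivAt (fun x => 4 * Real.pi ^ 2 * Real.sin x ^ 2 * Real.cos x ^ 2)
      (8 * Real.pi ^ 2 * Real.sin x * Real.cos x * (Real.cos x ^ 2 - Real.sin x ^ 2)) x := by
  refine ((hasDerivAt_sinSq x).mul ((Real.hasDerivAt_cos x).pow 2)).congr_deriv ?_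
  simp only [Pi.pow_apply]; push_cast; ring

lemma hasDerivAt_cosSq (x : ℝ) :
    HasDerivAt (fun x => 4 * Real.pi ^ 2 * Real.cos x ^ 2)
      (-8 * Real.pi ^ 2 * Real.sin x * Real.cos x) x := by
  refine (((Real.hasDerivAt_cos x).pow 2).const_mul (4 * Real.pi ^ 2)).congr_deriv ?_
  push_cast; ring

lemma hasDerivAt_cosSq_mul_cosSq (x : ℝ) :
    HasDerivAt (fun x => 4 * Real.pi ^ 2 * Real.cos x ^ 2 * Real.cos x ^ 2)
      (-16 * Real.pi ^ 2 * Real.sin x * Real.cos x ^ 3) x := by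
  refine ((hasDerivAt_cosSq x).mul ((Real.hasDerivAt_cos x).pow 2)).congr_deriv ?_
  simp only [Pi.pow_apply]; push_cast; ring

lemma IsUnitSpeedGeodesic.hasDerivAt_u {E G u v : ℝ → ℝ} (h : IsUnitSpeedGeodesic E G u v)
    (t : ℝ) : HasDerivAt u (deriv u t) t :=
  (h.smooth_u.differentiable (by simp) t).hasDerivAt

lemma IsUnitSpeedGeodesic.hasDerivAt_v {E G u v : ℝ → ℝ} (h : IsUnitSpeedGeodesic E G u v)
    (t : ℝ) : HasDerivAt v (deriv v t) t :=
  (h.smooth_v.differentiable (by simp) t).hasDerivAt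

lemma IsUnitSpeedGeodesic.hasDerivAt_deriv_u {E G u v : ℝ → ℝ}
    (h : IsUnitSpeedGeodesic E G u v) (t : ℝ) : HasDerivAt (deriv u) (deriv (deriv u) t) t :=
  (((contDiff_infty_iff_deriv.mp h.smooth_u).2).differentiable (by simp) t).hasDerivAt

lemma IsUnitSpeedGeodesic.hasDerivAt_deriv_v {E G u v : ℝ → ℝ}
    (h : IsUnitSpeedGeodesic E G u v) (t : ℝ) : HasDerivAt (deriv v) (deriv (deriv v) t) t :=
  (((contDiff_infty_iff_deriv.mp h.smooth_v).2).differentiable (by simp) t).hasDerivAt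

/-- Clairaut's relation. -/
lemma IsUnitSpeedGeodesic.clairaut {E G u v : ℝ → ℝ} (h : IsUnitSpeedGeodesic E G u v)
    (hG : ∀ x, DifferentiableAt ℝ G x) (hG0 : ∀ t, G (u t) ≠ 0) :
    ∃ C : ℝ, ∀ t, G (u t) * deriv v t = C := by
  -- The derivative of G(u) v' is G(u) times the second geodesic equation.
  have hd : ∀ t, HasDerivAt (fun t => G (u t) * deriv v t) 0 t := fun t => by
    refine ((((hG (u t)).hasDerivAt).comp t (h.hasDerivAt_u t)).mul
      (h.hasDerivAt_deriv_v t)).congr_deriv ?_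
    have := h.eq_v t
    have h0 := hG0 t
    field_simp at this
    simp only [Function.comp]
    linear_combination this
  exact ⟨_, fun t => is_const_of_deriv_eq_zero (fun t => (hd t).differentiableAt)
    (fun t => (hd t).deriv) t 0⟩

theorem IsUnitSpeedGeodesic.toricSystem {nu lam : ℝ → ℝ}
    (hnu : ∀ t, nu t ∈ Set.Ioo 0 (Real.pi / 2))
    (h : IsUnitSpeedGeodesic (fun x => 4 * Real.pi ^ 2 * Real.sin x ^ 2)
      (fun x => 4 * Real.pi ^ 2 * Real.sin x ^ 2 * Real.cos x ^ 2) nu lam) :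
    ∃ c, ToricSystem c (fun t => Real.sin (nu t) ^ 2)
      (fun t => 2 * Real.sin (nu t) * Real.cos (nu t) * deriv nu t) lam := by
  have hs : ∀ t, 0 < Real.sin (nu t) := fun t =>
    Real.sin_pos_of_pos_of_lt_pi (hnu t).1 (by have := (hnu t).2; linarith [Real.pi_pos])
  have hc : ∀ t, 0 < Real.cos (nu t) := fun t =>
    Real.cos_pos_of_mem_Ioo ⟨by have := (hnu t).1; linarith [Real.pi_pos], (hnu t).2⟩
  have hp := Real.pi_pos
  obtain ⟨C, hC⟩ := h.clairaut (fun x => (hasDerivAt_sinSq_mul_cosSq x).differentiableAt)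
    (fun t => by have := hs t; have := hc t; positivity)
  have hl : ∀ t, C / (2 * Real.pi) =
      2 * Real.pi * Real.sin (nu t) ^ 2 * Real.cos (nu t) ^ 2 * deriv lam t := fun t => by
    rw [← hC t]; field_simp; ring
  refine ⟨C / (2 * Real.pi), fun t => by have := hs t; positivity, fun t => ?_, fun t => ?_,
    fun t => ?_, fun t => ?_, fun t => ?_⟩
  · have := hc t
    nlinarith [Real.sin_sq_add_cos_sq (nu t)]
  · refine ((h.hasDerivAt_u t).sin.pow 2).congr_deriv ?_
    push_cast; ring
  · refine ((((h.hasDerivAt_u t).sin.const_mul 2).mul (h.hasDerivAt_u t).cos).mul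
      (h.hasDerivAt_deriv_u t)).congr_deriv ?_
    have e1 := h.eq_u t
    have e2 := h.unit_speed t
    rw [(hasDerivAt_sinSq _).deriv, (hasDerivAt_sinSq_mul_cosSq _).deriv] at e1
    have h1 := hs t; have h2 := hc t
    rw [hl t]
    set s := Real.sin (nu t)
    set k := Real.cos (nu t)
    field_simp at e1 e2 ⊢
    simp only [Pi.mul_apply]
    linear_combination k * Real.pi ^ 2 / 2 * e1 - e2
  · have e2 := h.unit_speed t
    have e3 := Real.sin_sq_add_cos_sq (nu t)
    have h1 := hs t; have h2 := hc t
    rw [hl t]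
    set s := Real.sin (nu t)
    set k := Real.cos (nu t)
    field_simp at e2 ⊢
    linear_combination k ^ 2 * e2 + e3
  · refine (h.hasDerivAt_v t).congr_deriv ?_
    have h1 := hs t; have h2 := hc t
    rw [hl t, ← Real.cos_sq']
    field_simp

/-- The first geodesic equation comes from the equation for z₁'. Differentiating the energy would
not give it where z₁ = 0, which is why the system contains both. -/
theorem ToricSystem.isUnitSpeedGeodesic {c : ℝ} {z z₁ nu lam : ℝ → ℝ}
    (h : ToricSystem c z z₁ lam) (hnu : ∀ t, nu t ∈ Set.Ioo 0 (Real.pi / 2))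
    (hz : ∀ t, z t = Real.sin (nu t) ^ 2) (hsnu : ContDiff ℝ ∞ nu) (hslam : ContDiff ℝ ∞ lam) :
    IsUnitSpeedGeodesic (fun x => 4 * Real.pi ^ 2 * Real.sin x ^ 2)
      (fun x => 4 * Real.pi ^ 2 * Real.sin x ^ 2 * Real.cos x ^ 2) nu lam := by
  have hs : ∀ t, 0 < Real.sin (nu t) := fun t =>
    Real.sin_pos_of_pos_of_lt_pi (hnu t).1 (by have := (hnu t).2; linarith [Real.pi_pos])
  have hc : ∀ t, 0 < Real.cos (nu t) := fun t =>
    Real.cos_pos_of_mem_Ioo ⟨by have := (hnu t).1; linarith [Real.pi_pos], (hnu t).2⟩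
  have hp := Real.pi_pos
  have hdnu : ∀ t, HasDerivAt nu (deriv nu t) t := fun t =>
    (hsnu.differentiable (by simp) t).hasDerivAt
  have hddnu : ∀ t, HasDerivAt (deriv nu) (deriv (deriv nu) t) t := fun t =>
    ((contDiff_infty_iff_deriv.mp hsnu).2.differentiable (by simp) t).hasDerivAt
  have hz' : z = fun t => Real.sin (nu t) ^ 2 := funext hz
  have hz₁ : z₁ = fun t => 2 * Real.sin (nu t) * Real.cos (nu t) * deriv nu t := by
    funext t
    have h1 := h.hasDerivAt t
    rw [hz'] at h1
    rw [h1.unique ((hdnu t).sin.pow 2)]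
    push_cast; ring
  have hl : ∀ t, deriv lam t = c / (2 * Real.pi * Real.sin (nu t) ^ 2 * Real.cos (nu t) ^ 2) :=
    fun t => by rw [(h.hasDerivAt_angle t).deriv, hz t, ← Real.cos_sq']
  have hsp : ∀ t, 4 * Real.pi ^ 2 * Real.sin (nu t) ^ 2 * deriv nu t ^ 2
      + 4 * Real.pi ^ 2 * Real.sin (nu t) ^ 2 * Real.cos (nu t) ^ 2 * deriv lam t ^ 2 = 1 := by
    intro t
    have e1 := h.energy t
    have e3 := Real.sin_sq_add_cos_sq (nu t)
    have h1 := hs t; have h2 := hc t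
    rw [hz', hz₁] at e1
    rw [hl]
    beta_reduce at e1
    set s := Real.sin (nu t)
    set k := Real.cos (nu t)
    field_simp at e1 ⊢
    linear_combination 4 * e1 - 4 * s ^ 2 * e3
  have hcl : ∀ t, c = 2 * Real.pi * Real.sin (nu t) ^ 2 * Real.cos (nu t) ^ 2 * deriv lam t :=
    fun t => by
      have h1 := hs t; have h2 := hc t
      rw [hl t]; field_simp
  refine ⟨hsnu, hslam, fun t => ?_, fun t => ?_, hsp⟩
  · have e1 := h.hasDerivAt' t
    rw [hz', hz₁] at e1
    replace e1 := e1.unique ((((hdnu t).sin.const_mul 2).mul (hdnu t).cos).mul (hddnu t))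
    rw [(hasDerivAt_sinSq _).deriv, (hasDerivAt_sinSq_mul_cosSq _).deriv]
    have e2 := hsp t
    have e3 := Real.sin_sq_add_cos_sq (nu t)
    have h1 := hs t; have h2 := hc t
    rw [hcl t] at e1
    simp only [Pi.mul_apply] at e1
    set s := Real.sin (nu t)
    set k := Real.cos (nu t)
    field_simp at e1 e2 ⊢
    have : k * Real.pi ^ 2 / 2 ≠ 0 := by positivity
    apply mul_left_cancel₀ this
    linear_combination -e1 + e2
  · rw [(hasDerivAt_sinSq_mul_cosSq _).deriv]
    have h1 := hs t; have h2 := hc t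
    have hdl : HasDerivAt (deriv lam) (deriv (deriv lam) t) t :=
      ((contDiff_infty_iff_deriv.mp hslam).2.differentiable (by simp) t).hasDerivAt
    -- The second geodesic equation is the derivative of Clairaut's relation, whose right-hand side
    -- c is constant.
    have := ((((hdnu t).sin.pow 2).const_mul (2 * Real.pi)).mul ((hdnu t).cos.pow 2)).mul hdl
    have e1 := this.unique ((hasDerivAt_const t c).congr_of_eventuallyEq
      (Filter.Eventually.of_forall fun x => (hcl x).symm))
    simp only [Pi.mul_apply, Pi.pow_apply] at e1
    push_cast at e1
    field_simp at e1 ⊢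
    linear_combination 4 * (mul_eq_zero.mp e1).resolve_left (by positivity)

theorem IsUnitSpeedGeodesic.dualSystem {phi theta : ℝ → ℝ}
    (hphi : ∀ t, phi t ∈ Set.Ioo (-(Real.pi / 2)) (Real.pi / 2))
    (h : IsUnitSpeedGeodesic (fun x => 4 * Real.pi ^ 2 * Real.cos x ^ 2)
      (fun x => 4 * Real.pi ^ 2 * Real.cos x ^ 2 * Real.cos x ^ 2) phi theta) :
    ∃ k, DualSystem k (fun t => Real.sin (phi t))
      (fun t => Real.cos (phi t) * deriv phi t) theta := by
  have hc : ∀ t, 0 < Real.cos (phi t) := fun t => Real.cos_pos_of_mem_Ioo (hphi t)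
  have hp := Real.pi_pos
  obtain ⟨C, hC⟩ := h.clairaut (fun x => (hasDerivAt_cosSq_mul_cosSq x).differentiableAt)
    (fun t => by have := hc t; positivity)
  have hl : ∀ t, C / (2 * Real.pi) = 2 * Real.pi * Real.cos (phi t) ^ 4 * deriv theta t :=
    fun t => by rw [← hC t]; field_simp; ring
  refine ⟨C / (2 * Real.pi), fun t => ?_, fun t => ?_, fun t => ?_, fun t => ?_, fun t => ?_⟩
  · have := hc t
    nlinarith [Real.sin_sq_add_cos_sq (phi t)]
  · exact (h.hasDerivAt_u t).sin
  · refine ((h.hasDerivAt_u t).cos.mul (h.hasDerivAt_deriv_u t)).congr_deriv ?_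
    have e1 := h.eq_u t
    rw [(hasDerivAt_cosSq _).deriv, (hasDerivAt_cosSq_mul_cosSq _).deriv] at e1
    have h2 := hc t
    have e3 := Real.sin_sq_add_cos_sq (phi t)
    rw [hl t, ← Real.cos_sq']
    set s := Real.sin (phi t)
    set k := Real.cos (phi t)
    field_simp at e1 ⊢
    linear_combination e1 / 8
  · have e2 := h.unit_speed t
    have h2 := hc t
    rw [hl t, ← Real.cos_sq']
    set k := Real.cos (phi t)
    field_simp at e2 ⊢
    linear_combination e2
  · refine (h.hasDerivAt_v t).congr_deriv ?_
    have h2 := hc t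
    rw [hl t, ← Real.cos_sq']
    field_simp

theorem DualSystem.isUnitSpeedGeodesic {k : ℝ} {y y₁ phi theta : ℝ → ℝ}
    (h : DualSystem k y y₁ theta)
    (hphi : ∀ t, phi t ∈ Set.Ioo (-(Real.pi / 2)) (Real.pi / 2))
    (hy : ∀ t, y t = Real.sin (phi t)) (hsphi : ContDiff ℝ ∞ phi)
    (hstheta : ContDiff ℝ ∞ theta) :
    IsUnitSpeedGeodesic (fun x => 4 * Real.pi ^ 2 * Real.cos x ^ 2)
      (fun x => 4 * Real.pi ^ 2 * Real.cos x ^ 2 * Real.cos x ^ 2) phi theta := by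
  have hc : ∀ t, 0 < Real.cos (phi t) := fun t => Real.cos_pos_of_mem_Ioo (hphi t)
  have hp := Real.pi_pos
  have hdphi : ∀ t, HasDerivAt phi (deriv phi t) t := fun t =>
    (hsphi.differentiable (by simp) t).hasDerivAt
  have hddphi : ∀ t, HasDerivAt (deriv phi) (deriv (deriv phi) t) t := fun t =>
    ((contDiff_infty_iff_deriv.mp hsphi).2.differentiable (by simp) t).hasDerivAt
  have hy' : y = fun t => Real.sin (phi t) := funext hy
  have hy₁ : y₁ = fun t => Real.cos (phi t) * deriv phi t := by
    funext t
    have h1 := h.hasDerivAt t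
    rw [hy'] at h1
    exact h1.unique (hdphi t).sin
  have hl : ∀ t, deriv theta t = k / (2 * Real.pi * Real.cos (phi t) ^ 4) :=
    fun t => by
      rw [(h.hasDerivAt_angle t).deriv, hy t, ← Real.cos_sq', ← pow_mul]
  have hcl : ∀ t, k = 2 * Real.pi * Real.cos (phi t) ^ 4 * deriv theta t :=
    fun t => by
      have h2 := hc t
      rw [hl t]; field_simp
  have hsp : ∀ t, 4 * Real.pi ^ 2 * Real.cos (phi t) ^ 2 * deriv phi t ^ 2
      + 4 * Real.pi ^ 2 * Real.cos (phi t) ^ 2 * Real.cos (phi t) ^ 2 * deriv theta t ^ 2 = 1 := by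
    intro t
    have e1 := h.energy t
    have h2 := hc t
    rw [hy', hy₁] at e1
    beta_reduce at e1
    rw [hcl t, ← Real.cos_sq'] at e1
    field_simp at e1 ⊢
    linear_combination e1
  refine ⟨hsphi, hstheta, fun t => ?_, fun t => ?_, hsp⟩
  · have e1 := h.hasDerivAt' t
    rw [hy', hy₁] at e1
    replace e1 := e1.unique ((hdphi t).cos.mul (hddphi t))
    rw [(hasDerivAt_cosSq _).deriv, (hasDerivAt_cosSq_mul_cosSq _).deriv]
    have e3 := Real.sin_sq_add_cos_sq (phi t)
    have h2 := hc t
    rw [hcl t, ← Real.cos_sq'] at e1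
    beta_reduce at e1
    set s := Real.sin (phi t)
    set k := Real.cos (phi t)
    field_simp at e1 ⊢
    linear_combination -8 * e1
  · rw [(hasDerivAt_cosSq_mul_cosSq _).deriv]
    have h2 := hc t
    have hdl : HasDerivAt (deriv theta) (deriv (deriv theta) t) t :=
      ((contDiff_infty_iff_deriv.mp hstheta).2.differentiable (by simp) t).hasDerivAt
    have := (((hdphi t).cos.pow 4).const_mul (2 * Real.pi)).mul hdl
    have e1 := this.unique ((hasDerivAt_const t k).congr_of_eventuallyEq
      (Filter.Eventually.of_forall fun x => (hcl x).symm))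
    simp only [Pi.pow_apply] at e1
    push_cast at e1
    field_simp at e1 ⊢
    linear_combination 4 * (mul_eq_zero.mp e1).resolve_left (by positivity)

/-! ### Reparametrization and duality -/

/-- Meant for the two time changes: a bounded distance from a linear map forces both infinite
limits. -/
lemma surjective_of_abs_sub_mul_le {f : ℝ → ℝ} (hf : Continuous f) {a M : ℝ} (ha : 0 < a)
    (h : ∀ s, |f s - a * s| ≤ M) : Function.Surjective f := by
  refine hf.surjective ?_ ?_
  · refine Filter.tendsto_atTop_mono (f := fun s => a * s + -M)
      (fun s => by linarith [(abs_le.mp (h s)).1]) ?_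
    exact Filter.tendsto_atTop_add_const_right _ _ (Filter.tendsto_id.const_mul_atTop ha)
  · refine Filter.tendsto_atBot_mono (f := fun s => a * s + M)
      (fun s => by linarith [(abs_le.mp (h s)).2]) ?_
    exact Filter.tendsto_atBot_add_const_right _ _ (Filter.tendsto_id.const_mul_atBot ha)

/-- A smooth surjection of `ℝ` with positive derivative has a smooth inverse. -/
lemma exists_smooth_inverse {σ σ' : ℝ → ℝ} (hσ : ContDiff ℝ ∞ σ)
    (hd : ∀ s, HasDerivAt σ (σ' s) s) (hpos : ∀ s, 0 < σ' s) (hsurj : Function.Surjective σ) :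
    ∃ ρ : ℝ → ℝ, ContDiff ℝ ∞ ρ ∧ (∀ s, ρ (σ s) = s) ∧ (∀ t, σ (ρ t) = t) ∧
      ∀ t, HasDerivAt ρ (σ' (ρ t))⁻¹ t := by
  have hmono : StrictMono σ := strictMono_of_deriv_pos fun s => by rw [(hd s).deriv]; exact hpos s
  let e := (hmono.orderIsoOfSurjective σ hsurj).toHomeomorph
  have he : ∀ s, e s = σ s := fun s => rfl
  have hleft : ∀ s, e.symm (σ s) = s := fun s => e.symm_apply_apply s
  have hright : ∀ t, σ (e.symm t) = t := fun t => e.apply_symm_apply t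
  refine ⟨e.symm, e.contDiff_symm_deriv (fun s => (hpos s).ne') hd hσ, hleft, hright, fun t => ?_⟩
  exact (hd (e.symm t)).of_local_left_inverse e.symm.continuous.continuousAt (hpos _).ne'
    (Filter.Eventually.of_forall hright)

lemma ToricSystem.one_sub_sq_eq {c : ℝ} {z z₁ lam : ℝ → ℝ} (h : ToricSystem c z z₁ lam)
    (t : ℝ) : 1 - (Real.pi * z₁ t) ^ 2 = z t + c ^ 2 / z t := by
  linear_combination -h.energy t

/-- The geodesic of `S²` which is dual to a geodesic `(ν, lam)`. -/
theorem ToricSystem.dualSystem {c ε η : ℝ} {z z₁ lam ρ : ℝ → ℝ} (h : ToricSystem c z z₁ lam)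
    (hc : c ≠ 0) (hε : ε ^ 2 = 1)
    (hρ : ∀ t, HasDerivAt ρ (1 + c ^ 2 / z (ρ t) ^ 2)⁻¹ t) :
    DualSystem (-2 * c) (fun t => ε * Real.pi * z₁ (ρ t))
      (fun t => ε * (c ^ 2 - z (ρ t) ^ 2) / (2 * Real.pi * (z (ρ t) ^ 2 + c ^ 2)))
      (fun t => η - lam (ρ t) - Real.arctan (Real.pi * z (ρ t) * z₁ (ρ t) / c)) := by
  have hp := Real.pi_pos
  -- The energy equation in dual form, 1 - y² = z + c²/z; it makes all denominators of the dual
  -- system rational in z.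
  have hsq : ∀ t, 1 - (ε * Real.pi * z₁ (ρ t)) ^ 2 = z (ρ t) + c ^ 2 / z (ρ t) := fun t => by
    rw [← h.one_sub_sq_eq]
    linear_combination -(Real.pi * z₁ (ρ t)) ^ 2 * hε
  refine ⟨fun t => ?_, fun t => ?_, fun t => ?_, fun t => ?_, fun t => ?_⟩
  · have := hsq t
    have h1 := h.pos (ρ t)
    have : 0 < z (ρ t) + c ^ 2 / z (ρ t) := by positivity
    linarith
  · refine (((h.hasDerivAt' (ρ t)).comp t (hρ t)).const_mul (ε * Real.pi)).congr_deriv ?_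
    have h1 := h.pos (ρ t)
    have : 0 < z (ρ t) ^ 2 + c ^ 2 := by positivity
    field_simp
    ring
  · have h1 := h.pos (ρ t)
    have h2 : 0 < z (ρ t) ^ 2 + c ^ 2 := by positivity
    have hz := (h.hasDerivAt (ρ t)).comp t (hρ t)
    refine ((((hz.pow 2).const_sub (c ^ 2)).const_mul ε).div
      (((hz.pow 2).add_const (c ^ 2)).const_mul (2 * Real.pi)) (by
        simp only [Function.comp, Pi.pow_apply]; positivity)).congr_deriv ?_
    rw [hsq t]
    simp only [Function.comp, Pi.pow_apply]
    push_cast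
    field_simp
    ring
  · have h1 := h.pos (ρ t)
    have h2 : 0 < z (ρ t) ^ 2 + c ^ 2 := by positivity
    rw [hsq t]
    field_simp
    rw [hε]
    ring
  · have h1 := h.pos (ρ t)
    have h3 := h.lt_one (ρ t)
    have h2 : 0 < z (ρ t) ^ 2 + c ^ 2 := by positivity
    have h4 : 1 - z (ρ t) ≠ 0 := by linarith
    have hz := (h.hasDerivAt (ρ t)).comp t (hρ t)
    have hz₁ := (h.hasDerivAt' (ρ t)).comp t (hρ t)
    have hl := (h.hasDerivAt_angle (ρ t)).comp t (hρ t)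
    refine ((hl.const_sub η).sub (((hz.const_mul Real.pi).mul hz₁).div_const c).arctan).congr_deriv ?_
    rw [hsq t]
    simp only [Function.comp, Pi.mul_apply]
    have he := h.energy (ρ t)
    -- By the energy equation c² + π²z²z₁² = (c² + z²)(1 - z). The factor 1 - z matches the one in
    -- the denominator of λ', so it disappears from θ'.
    have e1 : 1 + (Real.pi * z (ρ t) * z₁ (ρ t) / c) ^ 2
        = (c ^ 2 + z (ρ t) ^ 2) * (1 - z (ρ t)) / c ^ 2 := by
      field_simp at he ⊢
      linear_combination z (ρ t) * he
    rw [e1]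
    have e2 : Real.pi * (z₁ (ρ t) * (1 + c ^ 2 / z (ρ t) ^ 2)⁻¹) * z₁ (ρ t) +
        Real.pi * z (ρ t) * ((-1 + c ^ 2 / z (ρ t) ^ 2) / (2 * Real.pi ^ 2) *
          (1 + c ^ 2 / z (ρ t) ^ 2)⁻¹) = (2 - 3 * z (ρ t) - c ^ 2 / z (ρ t)) / (2 * Real.pi)
            * (1 + c ^ 2 / z (ρ t) ^ 2)⁻¹ := by
      field_simp at he ⊢
      linear_combination 2 * he
    rw [e2]
    field_simp
    ring

/-- For k ≠ 0 the energy equation gives 4π²y₁² < 1. This makes both z and the speed of the inverse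
time change positive. -/
lemma DualSystem.one_sub_pos {k : ℝ} {y y₁ theta : ℝ → ℝ} (h : DualSystem k y y₁ theta)
    (hk : k ≠ 0) (t : ℝ) : 0 < 1 - 2 * Real.pi * y₁ t ∧ 0 < 1 + 2 * Real.pi * y₁ t := by
  have h1 := h.energy t
  have h2 := h.sq_lt_one t
  have h3 : 0 < k ^ 2 / (1 - y t ^ 2) ^ 2 := by
    have : 0 < 1 - y t ^ 2 := by linarith
    positivity
  constructor <;> nlinarith

/-- The geodesic of the orbit space of `S³` to which a geodesic `(φ, theta)` of `S²` is dual. -/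
theorem DualSystem.toricSystem {k η : ℝ} {y y₁ theta ρ : ℝ → ℝ} (h : DualSystem k y y₁ theta)
    (hk : k ≠ 0) (hρ : ∀ t, HasDerivAt ρ ((1 - 2 * Real.pi * y₁ (ρ t)) / 2)⁻¹ t) :
    ToricSystem (-k / 2) (fun t => (1 - y (ρ t) ^ 2) * (1 - 2 * Real.pi * y₁ (ρ t)) / 2)
      (fun t => y (ρ t) / Real.pi)
      (fun t => η - theta (ρ t) - Real.arctan
        ((1 - y (ρ t) ^ 2) * (1 - 2 * Real.pi * y₁ (ρ t)) / 2 * y (ρ t) / (-k / 2))) := by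
  have hp := Real.pi_pos
  have hP := fun t => (h.one_sub_pos hk t).1
  have hQ := fun t => (h.one_sub_pos hk t).2
  have hW : ∀ t, 0 < 1 - y t ^ 2 := fun t => by linarith [h.sq_lt_one t]
  -- The energy equation solved for k², with 1 - (2πy₁)² factored; it eliminates k² from every
  -- identity below.
  have hk2 : ∀ t, k ^ 2 = (1 - y t ^ 2) ^ 2 * ((1 - 2 * Real.pi * y₁ t) *
      (1 + 2 * Real.pi * y₁ t)) := fun t => by
    have h1 := h.energy t
    have h2 := hW t
    field_simp at h1
    linear_combination h1
  have hz : ∀ t, HasDerivAt (fun t => (1 - y t ^ 2) * (1 - 2 * Real.pi * y₁ t) / 2)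
      (y t * (1 - 2 * Real.pi * y₁ t) / (2 * Real.pi)) t := fun t => by
    have h1 := hW t
    refine (((((h.hasDerivAt t).pow 2).const_sub 1).mul
      (((h.hasDerivAt' t).const_mul (2 * Real.pi)).const_sub 1)).div_const 2).congr_deriv ?_
    rw [neg_mul, hk2 t]
    simp only [Pi.pow_apply]
    push_cast
    field_simp
    ring
  refine ⟨fun t => ?_, fun t => ?_, fun t => ?_, fun t => ?_, fun t => ?_, fun t => ?_⟩
  · have := hP (ρ t); have := hW (ρ t); positivity
  -- The factors 1 - 2πy₁ and 1 + 2πy₁ are positive with sum 2, and 0 < 1 - y² ≤ 1.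
  · nlinarith [hP (ρ t), hW (ρ t), hQ (ρ t), mul_pos (hQ (ρ t)) (hW (ρ t)), sq_nonneg (y (ρ t))]
  · refine ((hz (ρ t)).comp t (hρ t)).congr_deriv ?_
    have := hP (ρ t)
    field_simp
  · refine (((h.hasDerivAt (ρ t)).comp t (hρ t)).div_const Real.pi).congr_deriv ?_
    have h1 := hP (ρ t); have h2 := hW (ρ t)
    rw [div_pow, neg_sq, hk2 (ρ t)]
    obtain ⟨P, hPd⟩ : ∃ P, P = 1 - 2 * Real.pi * y₁ (ρ t) := ⟨_, rfl⟩
    have hy₁ : y₁ (ρ t) = (1 - P) / (2 * Real.pi) := by rw [hPd]; field_simp; ring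
    rw [← hPd] at h1 ⊢
    rw [hy₁]
    field_simp
    ring
  · have h1 := hP (ρ t); have h2 := hW (ρ t)
    rw [div_pow, div_pow, neg_sq, hk2 (ρ t)]
    obtain ⟨P, hPd⟩ : ∃ P, P = 1 - 2 * Real.pi * y₁ (ρ t) := ⟨_, rfl⟩
    have hQ' : 1 + 2 * Real.pi * y₁ (ρ t) = 2 - P := by rw [hPd]; ring
    rw [← hPd, hQ']
    rw [← hPd] at h1
    field_simp
    ring
  · have h1 := hP (ρ t); have h2 := hW (ρ t); have h3 := hQ (ρ t)
    have hzz := (hz (ρ t)).comp t (hρ t)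
    have hyy := (h.hasDerivAt (ρ t)).comp t (hρ t)
    have hth := (h.hasDerivAt_angle (ρ t)).comp t (hρ t)
    refine ((hth.const_sub η).sub ((hzz.mul hyy).div_const (-k / 2)).arctan).congr_deriv ?_
    have h4 : 1 - (1 - y (ρ t) ^ 2) * (1 - 2 * Real.pi * y₁ (ρ t)) / 2 ≠ 0 := by
      have : 0 < 1 - (1 - y (ρ t) ^ 2) * (1 - 2 * Real.pi * y₁ (ρ t)) / 2 := by
        nlinarith [mul_pos h3 h2, sq_nonneg (y (ρ t))]
      exact this.ne'
    simp only [Function.comp, Pi.mul_apply]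
    have hk' := hk2 (ρ t)
    set Y := y (ρ t)
    set W := y₁ (ρ t)
    -- The counterpart of the factorization used for the dual system: the factor 1 - z appears and
    -- cancels against the denominator of λ'.
    have e1 : 1 + ((1 - Y ^ 2) * (1 - 2 * Real.pi * W) / 2 * Y / (-k / 2)) ^ 2
        = 2 * (1 - (1 - Y ^ 2) * (1 - 2 * Real.pi * W) / 2) / (1 + 2 * Real.pi * W) := by
      rw [div_pow _ (-k / 2), div_pow (-k), neg_sq, hk']
      field_simp
      ring
    rw [e1]
    have e2 : 2 - (1 - Y ^ 2) * (1 - 2 * Real.pi * W) ≠ 0 := fun e => h4 (by linarith)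
    field_simp
    rw [hk']
    ring

/-! ### The unit normal fields of a rotation torus -/

lemma hasDerivAt_euclidean {n : ℕ} {f : ℝ → EuclideanSpace ℝ (Fin n)}
    {f' : EuclideanSpace ℝ (Fin n)} {t : ℝ}
    (h : ∀ i, HasDerivAt (fun s => f s i) (f' i) t) : HasDerivAt f f' t :=
  (EuclideanSpace.equiv (Fin n) ℝ).symm.hasFDerivAt.comp_hasDerivAt t (hasDerivAt_pi.mpr h)

lemma inner_fin_four (v w : EuclideanSpace ℝ (Fin 4)) :
    inner ℝ v w = v 0 * w 0 + v 1 * w 1 + v 2 * w 2 + v 3 * w 3 := by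
  simp only [PiLp.inner_apply, Fin.sum_univ_four, RCLike.inner_apply, conj_trivial]
  ring

lemma norm_eq_one_iff_fin_four (v : EuclideanSpace ℝ (Fin 4)) :
    ‖v‖ = 1 ↔ v 0 ^ 2 + v 1 ^ 2 + v 2 ^ 2 + v 3 ^ 2 = 1 := by
  rw [← sq_eq_sq₀ (norm_nonneg v) zero_le_one, one_pow, ← real_inner_self_eq_norm_sq,
    inner_fin_four]
  ring_nf

theorem hasDerivAt_rotationTorus_left (nu lam : ℝ → ℝ) (α t : ℝ) :
    HasDerivAt (fun β => rotationTorus nu lam β t)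
      (!₂[-Real.sin α * Real.sin (nu t), Real.cos α * Real.sin (nu t), 0, 0] :
        EuclideanSpace ℝ (Fin 4)) α := by
  refine hasDerivAt_euclidean fun i => ?_
  fin_cases i
  · exact (Real.hasDerivAt_cos α).mul_const (Real.sin (nu t))
  · exact (Real.hasDerivAt_sin α).mul_const (Real.sin (nu t))
  · exact hasDerivAt_const α (Real.cos (nu t) * Real.cos (lam t))
  · exact hasDerivAt_const α (Real.cos (nu t) * Real.sin (lam t))

theorem hasDerivAt_rotationTorus_right {nu lam : ℝ → ℝ} {ν' l' : ℝ} (α : ℝ) {t : ℝ}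
    (hn : HasDerivAt nu ν' t) (hl : HasDerivAt lam l' t) :
    HasDerivAt (fun s => rotationTorus nu lam α s)
      (!₂[Real.cos α * (Real.cos (nu t) * ν'), Real.sin α * (Real.cos (nu t) * ν'),
        -Real.sin (nu t) * ν' * Real.cos (lam t) + Real.cos (nu t) * (-Real.sin (lam t) * l'),
        -Real.sin (nu t) * ν' * Real.sin (lam t) + Real.cos (nu t) * (Real.cos (lam t) * l')] :
        EuclideanSpace ℝ (Fin 4)) t := by
  refine hasDerivAt_euclidean fun i => ?_
  fin_cases i
  · exact hn.sin.const_mul (Real.cos α)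
  · exact hn.sin.const_mul (Real.sin α)
  · exact hn.cos.mul hl.cos
  · exact hn.cos.mul hl.sin

/-- The `∂_ν`-component of the unit tangent vector of the curve `(nu, lam)` in the unit sphere, if
this curve has unit speed for the metric of the orbit space. -/
noncomputable def tangentNu (nu : ℝ → ℝ) (t : ℝ) : ℝ :=
  2 * Real.pi * Real.sin (nu t) * deriv nu t

/-- The component of the unit tangent vector along the parallel of the unit sphere. -/
noncomputable def tangentLam (nu lam : ℝ → ℝ) (t : ℝ) : ℝ :=
  2 * Real.pi * Real.sin (nu t) * Real.cos (nu t) * deriv lam t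

/-- A unit normal field of the rotation torus over `(nu, lam)`. -/
noncomputable def torusNormal (nu lam : ℝ → ℝ) (α t : ℝ) : EuclideanSpace ℝ (Fin 4) :=
  !₂[-(tangentLam nu lam t * Real.cos (nu t) * Real.cos α),
    -(tangentLam nu lam t * Real.cos (nu t) * Real.sin α),
    tangentLam nu lam t * Real.sin (nu t) * Real.cos (lam t) - tangentNu nu t * Real.sin (lam t),
    tangentLam nu lam t * Real.sin (nu t) * Real.sin (lam t) + tangentNu nu t * Real.cos (lam t)]

lemma IsUnitSpeedGeodesic.tangent_sq {nu lam : ℝ → ℝ}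
    (h : IsUnitSpeedGeodesic (fun x => 4 * Real.pi ^ 2 * Real.sin x ^ 2)
      (fun x => 4 * Real.pi ^ 2 * Real.sin x ^ 2 * Real.cos x ^ 2) nu lam) (t : ℝ) :
    tangentNu nu t ^ 2 + tangentLam nu lam t ^ 2 = 1 := by
  rw [← h.unit_speed t, tangentNu, tangentLam]
  ring

/-- The field is -g times the unit vector ∂_ν plus f times the unit vector along the parallel, that
is, the unit tangent (f, g) of the profile curve after a quarter turn; it is therefore orthogonal to
the profile and to the orbits. -/
theorem isUnitNormal_torusNormal {nu lam : ℝ → ℝ}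
    (h : IsUnitSpeedGeodesic (fun x => 4 * Real.pi ^ 2 * Real.sin x ^ 2)
      (fun x => 4 * Real.pi ^ 2 * Real.sin x ^ 2 * Real.cos x ^ 2) nu lam) :
    IsUnitNormal (rotationTorus nu lam) (torusNormal nu lam) := by
  refine ⟨?_, fun α t => ?_, fun α t => ?_, fun α t => ?_, fun α t => ?_⟩
  · have h1 : Continuous nu := h.smooth_u.continuous
    have h2 : Continuous lam := h.smooth_v.continuous
    have h3 : Continuous (deriv nu) := (contDiff_infty_iff_deriv.mp h.smooth_u).2.continuous
    have h4 : Continuous (deriv lam) := (contDiff_infty_iff_deriv.mp h.smooth_v).2.continuous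
    simp only [torusNormal, tangentNu, tangentLam]
    refine (PiLp.continuous_toLp 2 _).comp (continuous_pi fun i => ?_)
    fin_cases i <;> simp <;> fun_prop
  · rw [norm_eq_one_iff_fin_four]
    simp only [torusNormal, PiLp.toLp_apply, Matrix.cons_val]
    linear_combination h.tangent_sq t + tangentLam nu lam t ^ 2 * Real.cos (nu t) ^ 2 *
      Real.sin_sq_add_cos_sq α + tangentLam nu lam t ^ 2 * Real.sin_sq_add_cos_sq (nu t) +
      (tangentLam nu lam t ^ 2 * Real.sin (nu t) ^ 2 + tangentNu nu t ^ 2) *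
        Real.sin_sq_add_cos_sq (lam t)
  · rw [inner_fin_four]
    simp only [torusNormal, rotationTorus, PiLp.toLp_apply, Matrix.cons_val]
    linear_combination (-tangentLam nu lam t * Real.cos (nu t) * Real.sin (nu t)) *
      (Real.sin_sq_add_cos_sq α - Real.sin_sq_add_cos_sq (lam t))
  · rw [inner_fin_four, (hasDerivAt_rotationTorus_left nu lam α t).deriv]
    simp only [torusNormal, PiLp.toLp_apply, Matrix.cons_val]
    ring
  · have htan : tangentNu nu t * Real.cos (nu t) * deriv lam t
        - tangentLam nu lam t * deriv nu t = 0 := by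
      rw [tangentNu, tangentLam]; ring
    rw [inner_fin_four,
      (hasDerivAt_rotationTorus_right α (h.hasDerivAt_u t) (h.hasDerivAt_v t)).deriv]
    simp only [torusNormal, PiLp.toLp_apply, Matrix.cons_val]
    linear_combination
      (-tangentLam nu lam t * Real.cos (nu t) ^ 2 * deriv nu t) * Real.sin_sq_add_cos_sq α +
      (-tangentLam nu lam t * Real.sin (nu t) ^ 2 * deriv nu t +
        tangentNu nu t * Real.cos (nu t) * deriv lam t) * Real.sin_sq_add_cos_sq (lam t) -
      tangentLam nu lam t * deriv nu t * Real.sin_sq_add_cos_sq (nu t) +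
      htan

/-- The three orthogonality conditions leave a line in ℝ⁴. The proof determines it in the
orthonormal frame adapted to α, λ and ν. -/
theorem IsUnitNormal.exists_eq_smul_torusNormal {nu lam : ℝ → ℝ}
    {I' : ℝ → ℝ → EuclideanSpace ℝ (Fin 4)}
    (hnu : ∀ t, nu t ∈ Set.Ioo 0 (Real.pi / 2))
    (h : IsUnitSpeedGeodesic (fun x => 4 * Real.pi ^ 2 * Real.sin x ^ 2)
      (fun x => 4 * Real.pi ^ 2 * Real.sin x ^ 2 * Real.cos x ^ 2) nu lam)
    (hI : IsUnitNormal (rotationTorus nu lam) I') :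
    ∀ α t, ∃ e : ℝ, e ^ 2 = 1 ∧ I' α t = e • torusNormal nu lam α t := by
  have hs : ∀ t, 0 < Real.sin (nu t) := fun t =>
    Real.sin_pos_of_pos_of_lt_pi (hnu t).1 (by have := (hnu t).2; linarith [Real.pi_pos])
  intro α t
  have h0 := (norm_eq_one_iff_fin_four _).mp (hI.norm_eq_one α t)
  have h1 := hI.tangent α t
  have h2 := hI.normal_left α t
  have h3 := hI.normal_right α t
  rw [(hasDerivAt_rotationTorus_left nu lam α t).deriv] at h2
  rw [(hasDerivAt_rotationTorus_right α (h.hasDerivAt_u t) (h.hasDerivAt_v t)).deriv] at h3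
  rw [inner_fin_four] at h1 h2 h3
  simp only [rotationTorus, PiLp.toLp_apply, Matrix.cons_val] at h1 h2 h3
  have hfg := h.tangent_sq t
  have hsα := Real.sin_sq_add_cos_sq α
  have hsl := Real.sin_sq_add_cos_sq (lam t)
  have hsn := Real.sin_sq_add_cos_sq (nu t)
  -- P is the radial component in the plane e₁e₂; C and D are the radial and angular components in
  -- the plane e₃e₄.
  obtain ⟨P, hP⟩ : ∃ P, P = Real.cos α * I' α t 0 + Real.sin α * I' α t 1 := ⟨_, rfl⟩
  obtain ⟨C, hC⟩ : ∃ C, C = Real.cos (lam t) * I' α t 2 + Real.sin (lam t) * I' α t 3 := ⟨_, rfl⟩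
  obtain ⟨D, hD⟩ : ∃ D, D = Real.cos (lam t) * I' α t 3 - Real.sin (lam t) * I' α t 2 := ⟨_, rfl⟩
  have hA : Real.cos α * I' α t 1 - Real.sin α * I' α t 0 = 0 := by
    apply mul_left_cancel₀ (hs t).ne'
    linear_combination h2
  have k1 : Real.sin (nu t) * P + Real.cos (nu t) * C = 0 := by
    rw [hP, hC]; linear_combination h1
  -- The component along ∂_ν; orthogonality to the position vector removes the complementary one.
  obtain ⟨n, hn⟩ : ∃ n, n = Real.cos (nu t) * P - Real.sin (nu t) * C := ⟨_, rfl⟩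
  have hPn : P = Real.cos (nu t) * n := by
    rw [hn]; linear_combination Real.sin (nu t) * k1 - P * hsn
  have hCn : C = -Real.sin (nu t) * n := by
    rw [hn]; linear_combination Real.cos (nu t) * k1 - C * hsn
  have k2 : tangentNu nu t * n + tangentLam nu lam t * D = 0 := by
    rw [hn, hP, hC, hD, tangentNu, tangentLam]
    linear_combination 2 * Real.pi * Real.sin (nu t) * h3
  -- The component along `torusNormal`; the component along (f, g) vanishes by `k2`.
  obtain ⟨e, he⟩ : ∃ e, e = -tangentLam nu lam t * n + tangentNu nu t * D := ⟨_, rfl⟩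
  have hne : n = -tangentLam nu lam t * e := by
    rw [he]; linear_combination tangentNu nu t * k2 - n * hfg
  have hDe : D = tangentNu nu t * e := by
    rw [he]; linear_combination tangentLam nu lam t * k2 - D * hfg
  have w0 : I' α t 0 = Real.cos α * P := by
    rw [hP]; linear_combination (-I' α t 0) * hsα - Real.sin α * hA
  have w1 : I' α t 1 = Real.sin α * P := by
    rw [hP]; linear_combination (-I' α t 1) * hsα + Real.cos α * hA
  have w2 : I' α t 2 = Real.cos (lam t) * C - Real.sin (lam t) * D := by
    rw [hC, hD]; linear_combination (-I' α t 2) * hsl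
  have w3 : I' α t 3 = Real.sin (lam t) * C + Real.cos (lam t) * D := by
    rw [hC, hD]; linear_combination (-I' α t 3) * hsl
  refine ⟨e, ?_, ?_⟩
  · have : P ^ 2 + C ^ 2 + D ^ 2 = 1 := by
      rw [w0, w1, w2, w3] at h0
      linear_combination h0 - P ^ 2 * hsα - (C ^ 2 + D ^ 2) * hsl
    rw [hPn, hCn, hDe, hne] at this
    linear_combination this - tangentLam nu lam t ^ 2 * e ^ 2 * hsn - e ^ 2 * hfg
  · ext i
    fin_cases i <;> simp [torusNormal]
    · rw [w0, hPn, hne]; ring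
    · rw [w1, hPn, hne]; ring
    · rw [w2, hCn, hDe, hne]; ring
    · rw [w3, hCn, hDe, hne]; ring

/-- The pointwise sign is the inner product of two continuous fields, hence constant on the
connected plane. -/
theorem IsUnitNormal.eq_smul_torusNormal {nu lam : ℝ → ℝ}
    {I' : ℝ → ℝ → EuclideanSpace ℝ (Fin 4)}
    (hnu : ∀ t, nu t ∈ Set.Ioo 0 (Real.pi / 2))
    (h : IsUnitSpeedGeodesic (fun x => 4 * Real.pi ^ 2 * Real.sin x ^ 2)
      (fun x => 4 * Real.pi ^ 2 * Real.sin x ^ 2 * Real.cos x ^ 2) nu lam)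
    (hI : IsUnitNormal (rotationTorus nu lam) I') :
    ∃ ε : ℝ, (ε = 1 ∨ ε = -1) ∧ ∀ α t, I' α t = ε • torusNormal nu lam α t := by
  have hN := isUnitNormal_torusNormal h
  let F : ℝ × ℝ → ℝ := fun p => inner ℝ (I' p.1 p.2) (torusNormal nu lam p.1 p.2)
  have hF : ∀ α t, F (α, t) ^ 2 = 1 ∧ I' α t = F (α, t) • torusNormal nu lam α t := fun α t => by
    obtain ⟨e, he, heq⟩ := hI.exists_eq_smul_torusNormal hnu h α t
    have : F (α, t) = e := by
      change inner ℝ (I' α t) (torusNormal nu lam α t) = e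
      rw [heq, real_inner_smul_left, real_inner_self_eq_norm_sq, hN.norm_eq_one]
      ring
    rw [this]
    exact ⟨he, heq⟩
  have hcont : Continuous F := hI.continuous.inner hN.continuous
  clear_value F
  have hsq : Set.EqOn (F ^ 2) 1 Set.univ := fun p _ => (hF p.1 p.2).1
  rcases isPreconnected_univ.eq_one_or_eq_neg_one_of_sq_eq hcont.continuousOn hsq with h1 | h1
  · refine ⟨1, Or.inl rfl, fun α t => ?_⟩
    have h2 : F (α, t) = 1 := h1 (Set.mem_univ _)
    rw [(hF α t).2, h2]
  · refine ⟨-1, Or.inr rfl, fun α t => ?_⟩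
    have h2 : F (α, t) = -1 := h1 (Set.mem_univ _)
    rw [(hF α t).2, h2]

/-! ### The angle of a dual geodesic -/

/-- δ is ε times the sign of c, with 0 counted as positive. It selects the branch ±π/2 in the
formula for θ. -/
lemma exists_sign_mul_abs {ε c : ℝ} (hε : ε = 1 ∨ ε = -1) :
    ∃ δ : ℝ, (δ = 1 ∨ δ = -1) ∧ δ * |c| = ε * c := by
  rcases le_total 0 c with h | h
  · exact ⟨ε, hε, by rw [abs_of_nonneg h]⟩
  · refine ⟨-ε, ?_, by rw [abs_of_nonpos h]; ring⟩
    rcases hε with rfl | rfl <;> simp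

/-- For B ≠ 0 the number δπ/2 - arctan(A/B) is an argument of ε(A + iB) when δ is the sign of εB;
subtracting l multiplies by exp(-il). -/
lemma mul_sin_cos_sub_arctan {A B R δ ε l : ℝ} (hR : 0 < R) (hRAB : R ^ 2 = A ^ 2 + B ^ 2)
    (hB : B ≠ 0) (hδ : δ = 1 ∨ δ = -1) (hδB : δ * |B| = ε * B) :
    R * Real.sin (δ * (Real.pi / 2) - l - Real.arctan (A / B))
        = ε * (B * Real.cos l - A * Real.sin l) ∧
      R * Real.cos (δ * (Real.pi / 2) - l - Real.arctan (A / B))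
        = ε * (B * Real.sin l + A * Real.cos l) := by
  have hsqrt : Real.sqrt (1 + (A / B) ^ 2) = R / |B| := by
    rw [Real.sqrt_eq_iff_mul_self_eq (by positivity) (by positivity), div_mul_div_comm,
      abs_mul_abs_self]
    field_simp
    linear_combination -hRAB
  have hB' : 0 < |B| := abs_pos.mpr hB
  have h1 : δ * (R * Real.cos (Real.arctan (A / B))) = ε * B := by
    rw [Real.cos_arctan, hsqrt, ← hδB]
    field_simp
  have h2 : δ * (R * Real.sin (Real.arctan (A / B))) = ε * A := by
    rw [Real.sin_arctan, hsqrt]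
    field_simp
    linear_combination A * hδB
  have h3 : ∀ x, Real.sin (δ * (Real.pi / 2) - x) = δ * Real.cos x := fun x => by
    rcases hδ with rfl | rfl
    · rw [one_mul, Real.sin_pi_div_two_sub, one_mul]
    · rw [show -1 * (Real.pi / 2) - x = -(x + Real.pi / 2) by ring, Real.sin_neg,
        Real.sin_add_pi_div_two]
      ring
  have h4 : ∀ x, Real.cos (δ * (Real.pi / 2) - x) = δ * Real.sin x := fun x => by
    rcases hδ with rfl | rfl
    · rw [one_mul, Real.cos_pi_div_two_sub, one_mul]
    · rw [show -1 * (Real.pi / 2) - x = -(x + Real.pi / 2) by ring, Real.cos_neg,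
        Real.cos_add_pi_div_two]
      ring
  rw [sub_sub, h3, h4, Real.sin_add, Real.cos_add]
  constructor
  · linear_combination Real.cos l * h1 - Real.sin l * h2
  · linear_combination Real.sin l * h1 + Real.cos l * h2

/-- The bipolar surface of a rotation torus, expressed by a dual curve. -/
theorem wedge_torusNormal_eq {nu lam : ℝ → ℝ} {c ε δ φ θ s : ℝ}
    (hnu : ∀ t, nu t ∈ Set.Ioo 0 (Real.pi / 2))
    (h : IsUnitSpeedGeodesic (fun x => 4 * Real.pi ^ 2 * Real.sin x ^ 2)
      (fun x => 4 * Real.pi ^ 2 * Real.sin x ^ 2 * Real.cos x ^ 2) nu lam)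
    (hc : c ≠ 0)
    (hlam : deriv lam s = c / (2 * Real.pi * Real.sin (nu s) ^ 2 * (1 - Real.sin (nu s) ^ 2)))
    (hε : ε = 1 ∨ ε = -1) (hδ : δ = 1 ∨ δ = -1) (hδc : δ * |c| = ε * c)
    (hφ : 0 < Real.cos φ)
    (hsin : Real.sin φ = ε * Real.pi * (2 * Real.sin (nu s) * Real.cos (nu s) * deriv nu s))
    (hθ : θ = δ * (Real.pi / 2) - lam s - Real.arctan
      (Real.pi * Real.sin (nu s) ^ 2 * (2 * Real.sin (nu s) * Real.cos (nu s) * deriv nu s) / c))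
    (α : ℝ) :
    wedge (rotationTorus nu lam α s) (ε • torusNormal nu lam α s)
      = equator !₂[Real.cos α * Real.cos φ * Real.sin θ, Real.sin α * Real.cos φ * Real.sin θ,
          Real.cos α * Real.cos φ * Real.cos θ, Real.sin α * Real.cos φ * Real.cos θ,
          Real.sin φ] := by
  have hs : 0 < Real.sin (nu s) :=
    Real.sin_pos_of_pos_of_lt_pi (hnu s).1 (by have := (hnu s).2; linarith [Real.pi_pos])
  have hk : 0 < Real.cos (nu s) :=
    Real.cos_pos_of_mem_Ioo ⟨by have := (hnu s).1; linarith [Real.pi_pos], (hnu s).2⟩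
  have hp := Real.pi_pos
  have hε2 : ε ^ 2 = 1 := by rcases hε with rfl | rfl <;> norm_num
  have hfg := h.tangent_sq s
  have hsc := Real.sin_sq_add_cos_sq (nu s)
  have hg : tangentLam nu lam s = c / (Real.sin (nu s) * Real.cos (nu s)) := by
    rw [tangentLam, hlam, ← Real.cos_sq']
    field_simp
  have hsin' : Real.sin φ = ε * (tangentNu nu s * Real.cos (nu s)) := by
    rw [hsin, tangentNu]; ring
  have hg0 : tangentLam nu lam s ≠ 0 := by rw [hg]; positivity
  have hangle : Real.pi * Real.sin (nu s) ^ 2 *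
      (2 * Real.sin (nu s) * Real.cos (nu s) * deriv nu s) / c
      = tangentNu nu s * Real.sin (nu s) / tangentLam nu lam s := by
    rw [hg, tangentNu]; field_simp
  rw [hangle] at hθ
  -- The component g has the sign of c because sin ν cos ν > 0, so the same δ serves for it.
  have hδg : δ * |tangentLam nu lam s| = ε * tangentLam nu lam s := by
    rw [hg, abs_div, abs_of_pos (mul_pos hs hk), ← mul_div_assoc, hδc, mul_div_assoc]
  have hR : Real.cos φ ^ 2
      = (tangentNu nu s * Real.sin (nu s)) ^ 2 + tangentLam nu lam s ^ 2 := by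
    rw [Real.cos_sq', hsin']
    linear_combination (-(tangentNu nu s * Real.cos (nu s)) ^ 2) * hε2 - hfg -
      tangentNu nu s ^ 2 * hsc
  obtain ⟨h1, h2⟩ := mul_sin_cos_sub_arctan (l := lam s) hφ hR hg0 hδ hδg
  rw [← hθ] at h1 h2
  have hsl := Real.sin_sq_add_cos_sq (lam s)
  ext i
  fin_cases i <;>
    simp only [wedge, equator, rotationTorus, torusNormal, PiLp.toLp_apply, Matrix.cons_val,
      PiLp.smul_apply, smul_eq_mul, Fin.zero_eta, Fin.mk_one, Fin.reduceFinMk]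
  · ring
  · linear_combination (-Real.cos α) * h1 + Real.cos α * ε * tangentLam nu lam s * Real.cos (lam s) * hsc
  · linear_combination (-Real.cos α) * h2 + Real.cos α * ε * tangentLam nu lam s * Real.sin (lam s) * hsc
  · linear_combination (-Real.sin α) * h1 + Real.sin α * ε * tangentLam nu lam s * Real.cos (lam s) * hsc
  · linear_combination (-Real.sin α) * h2 + Real.sin α * ε * tangentLam nu lam s * Real.sin (lam s) * hsc
  · rw [hsin']
    linear_combination ε * tangentNu nu s * Real.cos (nu s) * hsl

/-! ### The dual of an Otsuki geodesic -/

lemma ContDiff.arcsin' {y : ℝ → ℝ} (hy : ContDiff ℝ ∞ y) (h : ∀ t, y t ^ 2 < 1) :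
    ContDiff ℝ ∞ (fun t => Real.arcsin (y t)) :=
  contDiff_iff_contDiffAt.mpr fun t =>
    (Real.contDiffAt_arcsin (fun e => by have := h t; rw [e] at this; norm_num at this)
      (fun e => by have := h t; rw [e] at this; norm_num at this)).comp t hy.contDiffAt

lemma arcsin_mem_Ioo {y : ℝ} (h : y ^ 2 < 1) :
    Real.arcsin y ∈ Set.Ioo (-(Real.pi / 2)) (Real.pi / 2) := by
  obtain ⟨h1, h2⟩ := (sq_lt_one_iff_abs_lt_one y).mp h |> abs_lt.mp
  exact ⟨Real.neg_pi_div_two_lt_arcsin.mpr h1, Real.arcsin_lt_pi_div_two.mpr h2⟩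

lemma sin_arcsin_of_sq_lt_one {y : ℝ} (h : y ^ 2 < 1) : Real.sin (Real.arcsin y) = y := by
  obtain ⟨h1, h2⟩ := (sq_lt_one_iff_abs_lt_one y).mp h |> abs_lt.mp
  exact Real.sin_arcsin h1.le h2.le

/-- Every unit normal field of the rotation torus over a closed geodesic comes from a closed
geodesic of `S²`. -/
theorem exists_dual_geodesic {nu lam : ℝ → ℝ} {I' : ℝ → ℝ → EuclideanSpace ℝ (Fin 4)} {c : ℝ}
    (hnu : ∀ t, nu t ∈ Set.Ioo 0 (Real.pi / 2))
    (h : IsUnitSpeedGeodesic (fun x => 4 * Real.pi ^ 2 * Real.sin x ^ 2)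
      (fun x => 4 * Real.pi ^ 2 * Real.sin x ^ 2 * Real.cos x ^ 2) nu lam)
    (hclosed : IsClosedCurve nu lam)
    (hc : c ≠ 0)
    (hsys : ToricSystem c (fun t => Real.sin (nu t) ^ 2)
      (fun t => 2 * Real.sin (nu t) * Real.cos (nu t) * deriv nu t) lam)
    (hI : IsUnitNormal (rotationTorus nu lam) I') :
    ∃ (phi theta : ℝ → ℝ) (y₁ : ℝ → ℝ), IsClosedGeodesic phi theta ∧
      SameImmersion nu lam I' phi theta ∧
      DualSystem (-2 * c) (fun t => Real.sin (phi t)) y₁ theta := by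
  have hp := Real.pi_pos
  obtain ⟨ε, hε, hIε⟩ := hI.eq_smul_torusNormal hnu h
  have hε2 : ε ^ 2 = 1 := by rcases hε with rfl | rfl <;> norm_num
  obtain ⟨δ, hδ, hδc⟩ := exists_sign_mul_abs (c := c) hε
  have hsnu : ContDiff ℝ ∞ nu := h.smooth_u
  have hslam : ContDiff ℝ ∞ lam := h.smooth_v
  have hsnu' : ContDiff ℝ ∞ (deriv nu) := (contDiff_infty_iff_deriv.mp hsnu).2
  have hsz : ContDiff ℝ ∞ (fun t => Real.sin (nu t) ^ 2) := hsnu.sin.pow 2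
  have hsz₁ : ContDiff ℝ ∞ (fun t => 2 * Real.sin (nu t) * Real.cos (nu t) * deriv nu t) :=
    ((contDiff_const.mul hsnu.sin).mul hsnu.cos).mul hsnu'
  obtain ⟨T, hT, m, hTm⟩ := hclosed
  have hper : ∀ t, deriv nu (t + T) = deriv nu t := fun t => by
    rw [← deriv_comp_add_const]
    congr 1
    funext s
    exact (hTm s).1
  generalize hz : (fun t => Real.sin (nu t) ^ 2) = z at hsys hsz
  generalize hz₁ : (fun t => 2 * Real.sin (nu t) * Real.cos (nu t) * deriv nu t) = z₁ at hsys hsz₁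
  have hzT : ∀ t, z (t + T) = z t := fun t => by simp only [← hz, (hTm t).1]
  have hz₁T : ∀ t, z₁ (t + T) = z₁ t := fun t => by simp only [← hz₁, (hTm t).1, hper]
  -- The new time: since 2π²z₁' = -1 + c²/z², the density 1 + c²/z² has the elementary primitive 2s
  -- + 2π²z₁.
  obtain ⟨σ, hσ⟩ : ∃ σ : ℝ → ℝ, σ = fun s => 2 * s + 2 * Real.pi ^ 2 * z₁ s := ⟨_, rfl⟩
  have hσd : ∀ s, HasDerivAt σ (1 + c ^ 2 / z s ^ 2) s := fun s => by
    rw [hσ]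
    refine (((hasDerivAt_id s).const_mul 2).add
      ((hsys.hasDerivAt' s).const_mul (2 * Real.pi ^ 2))).congr_deriv ?_
    field_simp
    ring
  have hσs : ContDiff ℝ ∞ σ := by
    rw [hσ]; exact (contDiff_const.mul contDiff_id).add (contDiff_const.mul hsz₁)
  have hbound : ∀ s, |σ s - 2 * s| ≤ 2 * Real.pi := fun s => by
    have h1 := hsys.energy s
    have h2 := hsys.pos s
    have h3 : 0 ≤ c ^ 2 / z s := by positivity
    have h4 : |Real.pi * z₁ s| ≤ 1 := by
      rw [← sq_le_one_iff_abs_le_one]; nlinarith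
    have : σ s - 2 * s = 2 * Real.pi * (Real.pi * z₁ s) := by rw [hσ]; ring
    rw [this, abs_mul, abs_of_pos (by positivity : 0 < 2 * Real.pi)]
    nlinarith
  obtain ⟨ρ, hρs, hρσ, hσρ, hρd⟩ := exists_smooth_inverse hσs hσd
    (fun s => by have := hsys.pos s; positivity)
    (surjective_of_abs_sub_mul_le hσs.continuous two_pos hbound)
  -- As z₁ has period T, σ(s + T) = σ(s) + 2T, so the dual curve closes after time 2T.
  have hρT : ∀ t, ρ (t + 2 * T) = ρ t + T := fun t => by
    have : σ (ρ t + T) = t + 2 * T := by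
      rw [← hσρ t, hρσ, hσ]
      simp only [hz₁T]
      ring
    rw [← this, hρσ]
  have hdual := hsys.dualSystem (η := δ * (Real.pi / 2)) hc hε2 hρd
  have hsin : ∀ t, Real.sin (Real.arcsin (ε * Real.pi * z₁ (ρ t))) = ε * Real.pi * z₁ (ρ t) :=
    fun t => sin_arcsin_of_sq_lt_one (hdual.sq_lt_one t)
  have hmem : ∀ t, Real.arcsin (ε * Real.pi * z₁ (ρ t)) ∈
      Set.Ioo (-(Real.pi / 2)) (Real.pi / 2) := fun t => arcsin_mem_Ioo (hdual.sq_lt_one t)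
  have hphis := ContDiff.arcsin' (contDiff_const.mul (hsz₁.comp hρs)) hdual.sq_lt_one
  have hthetas : ContDiff ℝ ∞ (fun t => δ * (Real.pi / 2) - lam (ρ t) -
      Real.arctan (Real.pi * z (ρ t) * z₁ (ρ t) / c)) :=
    (contDiff_const.sub (hslam.comp hρs)).sub (Real.contDiff_arctan.comp
      (((contDiff_const.mul (hsz.comp hρs)).mul (hsz₁.comp hρs)).div_const c))
  refine ⟨fun t => Real.arcsin (ε * Real.pi * z₁ (ρ t)), fun t => δ * (Real.pi / 2) - lam (ρ t) -
    Real.arctan (Real.pi * z (ρ t) * z₁ (ρ t) / c),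
    fun t => ε * (c ^ 2 - z (ρ t) ^ 2) / (2 * Real.pi * (z (ρ t) ^ 2 + c ^ 2)),
    ⟨hmem, ?_, ?_⟩, ?_, ?_⟩
  · exact hdual.isUnitSpeedGeodesic hmem (fun t => (hsin t).symm) hphis hthetas
  -- The winding number changes sign because θ contains -λ; the arctangent term is periodic.
  · refine ⟨2 * T, by positivity, -m, fun t => ?_⟩
    simp only [hρT, hzT, hz₁T, (hTm _).2]
    refine ⟨trivial, ?_⟩
    push_cast
    ring
  · refine ⟨ρ, hρs, fun t => ?_, fun s => ⟨σ s, hρσ s⟩, fun α t => ?_⟩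
    · rw [(hρd t).deriv]
      have := hsys.pos (ρ t)
      positivity
    · rw [hIε]
      refine wedge_torusNormal_eq hnu h hc ?_ hε hδ hδc (Real.cos_pos_of_mem_Ioo (hmem t)) ?_ ?_ α
      · rw [(hsys.hasDerivAt_angle (ρ t)).deriv, ← hz]
      · have e := hsin t
        simp only [← hz₁] at e ⊢
        exact e
      · simp only [← hz₁, ← hz]
  · exact (funext hsin).symm ▸ hdual

/-! ### The minimal immersions -/

lemma inner_fin_five (v w : EuclideanSpace ℝ (Fin 5)) :
    inner ℝ v w = v 0 * w 0 + v 1 * w 1 + v 2 * w 2 + v 3 * w 3 + v 4 * w 4 := by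
  simp only [PiLp.inner_apply, Fin.sum_univ_five, RCLike.inner_apply, conj_trivial]
  ring

lemma norm_sq_fin_five (v : EuclideanSpace ℝ (Fin 5)) :
    ‖v‖ ^ 2 = v 0 ^ 2 + v 1 ^ 2 + v 2 ^ 2 + v 3 ^ 2 + v 4 ^ 2 := by
  rw [← real_inner_self_eq_norm_sq, inner_fin_five]
  ring

theorem hasDerivAt_orbitImmersion_left (phi theta : ℝ → ℝ) (α t : ℝ) :
    HasDerivAt (fun β => orbitImmersion phi theta β t)
      (!₂[-Real.sin α * Real.cos (phi t) * Real.sin (theta t),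
        Real.cos α * Real.cos (phi t) * Real.sin (theta t),
        -Real.sin α * Real.cos (phi t) * Real.cos (theta t),
        Real.cos α * Real.cos (phi t) * Real.cos (theta t), 0] : EuclideanSpace ℝ (Fin 5)) α := by
  refine hasDerivAt_euclidean fun i => ?_
  fin_cases i
  · exact ((Real.hasDerivAt_cos α).mul_const _).mul_const _
  · exact ((Real.hasDerivAt_sin α).mul_const _).mul_const _
  · exact ((Real.hasDerivAt_cos α).mul_const _).mul_const _
  · exact ((Real.hasDerivAt_sin α).mul_const _).mul_const _
  · exact hasDerivAt_const α (Real.sin (phi t))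

theorem hasDerivAt_deriv_orbitImmersion_left (phi theta : ℝ → ℝ) (α t : ℝ) :
    HasDerivAt (deriv fun β => orbitImmersion phi theta β t)
      (!₂[-Real.cos α * Real.cos (phi t) * Real.sin (theta t),
        -Real.sin α * Real.cos (phi t) * Real.sin (theta t),
        -Real.cos α * Real.cos (phi t) * Real.cos (theta t),
        -Real.sin α * Real.cos (phi t) * Real.cos (theta t), 0] : EuclideanSpace ℝ (Fin 5)) α := by
  rw [funext fun α => (hasDerivAt_orbitImmersion_left phi theta α t).deriv]
  refine hasDerivAt_euclidean fun i => ?_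
  fin_cases i
  · exact ((Real.hasDerivAt_sin α).neg.mul_const _).mul_const _
  · exact ((Real.hasDerivAt_cos α).mul_const _).mul_const _
  · exact ((Real.hasDerivAt_sin α).neg.mul_const _).mul_const _
  · exact ((Real.hasDerivAt_cos α).mul_const _).mul_const _
  · exact hasDerivAt_const α (0 : ℝ)

theorem hasDerivAt_orbitImmersion_right {phi theta : ℝ → ℝ} {p₁ q₁ : ℝ} (α : ℝ) {t : ℝ}
    (hp : HasDerivAt phi p₁ t) (hq : HasDerivAt theta q₁ t) :
    HasDerivAt (fun s => orbitImmersion phi theta α s)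
      (!₂[Real.cos α * (-Real.sin (phi t) * p₁) * Real.sin (theta t)
            + Real.cos α * Real.cos (phi t) * (Real.cos (theta t) * q₁),
        Real.sin α * (-Real.sin (phi t) * p₁) * Real.sin (theta t)
            + Real.sin α * Real.cos (phi t) * (Real.cos (theta t) * q₁),
        Real.cos α * (-Real.sin (phi t) * p₁) * Real.cos (theta t)
            + Real.cos α * Real.cos (phi t) * (-Real.sin (theta t) * q₁),
        Real.sin α * (-Real.sin (phi t) * p₁) * Real.cos (theta t)
            + Real.sin α * Real.cos (phi t) * (-Real.sin (theta t) * q₁),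
        Real.cos (phi t) * p₁] : EuclideanSpace ℝ (Fin 5)) t := by
  refine hasDerivAt_euclidean fun i => ?_
  fin_cases i
  · exact (hp.cos.const_mul _).mul hq.sin
  · exact (hp.cos.const_mul _).mul hq.sin
  · exact (hp.cos.const_mul _).mul hq.cos
  · exact (hp.cos.const_mul _).mul hq.cos
  · exact hp.sin

theorem hasDerivAt_deriv_orbitImmersion_right {phi theta : ℝ → ℝ} {p₂ q₂ : ℝ} (α : ℝ) {t : ℝ}
    (hp : Differentiable ℝ phi) (hq : Differentiable ℝ theta)
    (hp₂ : HasDerivAt (deriv phi) p₂ t) (hq₂ : HasDerivAt (deriv theta) q₂ t) :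
    HasDerivAt (deriv fun s => orbitImmersion phi theta α s)
      (!₂[(Real.cos α * ((-(Real.cos (phi t) * deriv phi t)) * deriv phi t
              + -Real.sin (phi t) * p₂)) * Real.sin (theta t)
            + (Real.cos α * (-Real.sin (phi t) * deriv phi t)) *
              (Real.cos (theta t) * deriv theta t)
            + ((Real.cos α * (-Real.sin (phi t) * deriv phi t)) * (Real.cos (theta t) * deriv theta t)
              + Real.cos α * Real.cos (phi t) * ((-Real.sin (theta t) * deriv theta t) *
                deriv theta t + Real.cos (theta t) * q₂)),
        (Real.sin α * ((-(Real.cos (phi t) * deriv phi t)) * deriv phi t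
              + -Real.sin (phi t) * p₂)) * Real.sin (theta t)
            + (Real.sin α * (-Real.sin (phi t) * deriv phi t)) *
              (Real.cos (theta t) * deriv theta t)
            + ((Real.sin α * (-Real.sin (phi t) * deriv phi t)) * (Real.cos (theta t) * deriv theta t)
              + Real.sin α * Real.cos (phi t) * ((-Real.sin (theta t) * deriv theta t) *
                deriv theta t + Real.cos (theta t) * q₂)),
        (Real.cos α * ((-(Real.cos (phi t) * deriv phi t)) * deriv phi t
              + -Real.sin (phi t) * p₂)) * Real.cos (theta t)
            + (Real.cos α * (-Real.sin (phi t) * deriv phi t)) *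
              (-Real.sin (theta t) * deriv theta t)
            + ((Real.cos α * (-Real.sin (phi t) * deriv phi t)) * (-Real.sin (theta t) * deriv theta t)
              + Real.cos α * Real.cos (phi t) * ((-(Real.cos (theta t) * deriv theta t)) *
                deriv theta t + -Real.sin (theta t) * q₂)),
        (Real.sin α * ((-(Real.cos (phi t) * deriv phi t)) * deriv phi t
              + -Real.sin (phi t) * p₂)) * Real.cos (theta t)
            + (Real.sin α * (-Real.sin (phi t) * deriv phi t)) *
              (-Real.sin (theta t) * deriv theta t)
            + ((Real.sin α * (-Real.sin (phi t) * deriv phi t)) * (-Real.sin (theta t) * deriv theta t)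
              + Real.sin α * Real.cos (phi t) * ((-(Real.cos (theta t) * deriv theta t)) *
                deriv theta t + -Real.sin (theta t) * q₂)),
        (-Real.sin (phi t) * deriv phi t) * deriv phi t + Real.cos (phi t) * p₂] :
        EuclideanSpace ℝ (Fin 5)) t := by
  rw [funext fun t => (hasDerivAt_orbitImmersion_right α (hp t).hasDerivAt (hq t).hasDerivAt).deriv]
  have h1 := (hp t).hasDerivAt
  have h2 := (hq t).hasDerivAt
  refine hasDerivAt_euclidean fun i => ?_
  fin_cases i
  · exact (((h1.sin.neg.mul hp₂).const_mul _).mul h2.sin).add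
      ((h1.cos.const_mul _).mul (h2.cos.mul hq₂))
  · exact (((h1.sin.neg.mul hp₂).const_mul _).mul h2.sin).add
      ((h1.cos.const_mul _).mul (h2.cos.mul hq₂))
  · exact (((h1.sin.neg.mul hp₂).const_mul _).mul h2.cos).add
      ((h1.cos.const_mul _).mul (h2.sin.neg.mul hq₂))
  · exact (((h1.sin.neg.mul hp₂).const_mul _).mul h2.cos).add
      ((h1.cos.const_mul _).mul (h2.sin.neg.mul hq₂))
  · exact h1.cos.mul hp₂

lemma norm_sq_orbitImmersion_left {phi theta : ℝ → ℝ} (α t : ℝ) :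
    ‖deriv (fun β => orbitImmersion phi theta β t) α‖ ^ 2 = Real.cos (phi t) ^ 2 := by
  rw [(hasDerivAt_orbitImmersion_left phi theta α t).deriv, norm_sq_fin_five]
  simp only [Matrix.cons_val]
  linear_combination Real.cos (phi t) ^ 2 * (Real.sin (theta t) ^ 2 + Real.cos (theta t) ^ 2) *
    Real.sin_sq_add_cos_sq α + Real.cos (phi t) ^ 2 * Real.sin_sq_add_cos_sq (theta t)

lemma norm_sq_orbitImmersion_right {phi theta : ℝ → ℝ} (hp : Differentiable ℝ phi)
    (hq : Differentiable ℝ theta) (α t : ℝ) :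
    ‖deriv (fun s => orbitImmersion phi theta α s) t‖ ^ 2
      = deriv phi t ^ 2 + Real.cos (phi t) ^ 2 * deriv theta t ^ 2 := by
  rw [(hasDerivAt_orbitImmersion_right α (hp t).hasDerivAt (hq t).hasDerivAt).deriv,
    norm_sq_fin_five]
  simp only [Matrix.cons_val]
  linear_combination (Real.sin (phi t) ^ 2 * deriv phi t ^ 2
      + Real.cos (phi t) ^ 2 * deriv theta t ^ 2) *
      (Real.sin (theta t) ^ 2 + Real.cos (theta t) ^ 2) * Real.sin_sq_add_cos_sq α
    + (Real.sin (phi t) ^ 2 * deriv phi t ^ 2 + Real.cos (phi t) ^ 2 * deriv theta t ^ 2) *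
      Real.sin_sq_add_cos_sq (theta t) + deriv phi t ^ 2 * Real.sin_sq_add_cos_sq (phi t)

lemma inner_orbitImmersion_left_right {phi theta : ℝ → ℝ} (hp : Differentiable ℝ phi)
    (hq : Differentiable ℝ theta) (α t : ℝ) :
    inner ℝ (deriv (fun β => orbitImmersion phi theta β t) α)
      (deriv (fun s => orbitImmersion phi theta α s) t) = 0 := by
  rw [(hasDerivAt_orbitImmersion_left phi theta α t).deriv,
    (hasDerivAt_orbitImmersion_right α (hp t).hasDerivAt (hq t).hasDerivAt).deriv, inner_fin_five]
  simp only [Matrix.cons_val]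
  ring

/-- The coordinate vector fields are orthogonal with |J_α| = cos φ, so the mixed term drops out. The
remaining trace, paired with a normal w, is a combination of the two geodesic equations and of the
conditions w ⊥ J and w ⊥ J_t. -/
theorem IsClosedGeodesic.isMinimalImmersionInSphere {phi theta : ℝ → ℝ}
    (h : IsClosedGeodesic phi theta) :
    IsMinimalImmersionInSphere (orbitImmersion phi theta) := by
  have hg := h.geodesic
  have hc : ∀ t, 0 < Real.cos (phi t) := fun t => Real.cos_pos_of_mem_Ioo (h.phi_mem t)
  have hp : Differentiable ℝ phi := hg.smooth_u.differentiable (by simp)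
  have hq : Differentiable ℝ theta := hg.smooth_v.differentiable (by simp)
  have hpi := Real.pi_pos
  refine ⟨?_, fun α t => ?_, fun α t => ?_, fun α t w h1 h2 h3 => ?_⟩
  · have h1 : ContDiff ℝ ∞ (fun x : ℝ × ℝ => Real.cos x.1) := contDiff_fst.cos
    have h2 : ContDiff ℝ ∞ (fun x : ℝ × ℝ => Real.sin x.1) := contDiff_fst.sin
    have h3 : ContDiff ℝ ∞ (fun x : ℝ × ℝ => phi x.2) := hg.smooth_u.comp contDiff_snd
    have h4 : ContDiff ℝ ∞ (fun x : ℝ × ℝ => theta x.2) := hg.smooth_v.comp contDiff_snd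
    rw [contDiff_euclidean]
    intro i
    fin_cases i
    · exact (h1.mul h3.cos).mul h4.sin
    · exact (h2.mul h3.cos).mul h4.sin
    · exact (h1.mul h3.cos).mul h4.cos
    · exact (h2.mul h3.cos).mul h4.cos
    · exact h3.sin
  · rw [← sq_eq_sq₀ (norm_nonneg _) zero_le_one, norm_sq_fin_five]
    simp only [orbitImmersion, PiLp.toLp_apply, Matrix.cons_val]
    linear_combination Real.cos (phi t) ^ 2 * (Real.sin (theta t) ^ 2 + Real.cos (theta t) ^ 2) *
      Real.sin_sq_add_cos_sq α + Real.cos (phi t) ^ 2 * Real.sin_sq_add_cos_sq (theta t)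
      + Real.sin_sq_add_cos_sq (phi t)
  · have hF := inner_orbitImmersion_left_right hp hq α t
    have hl := norm_sq_orbitImmersion_left (phi := phi) (theta := theta) α t
    have hr : 0 < ‖deriv (fun s => orbitImmersion phi theta α s) t‖ ^ 2 := by
      rw [norm_sq_orbitImmersion_right hp hq]
      have h5 := hc t
      -- Unit speed says 4π² |J_α|² |J_t|² = 1, so J_t cannot vanish.
      have h4 : Real.cos (phi t) ^ 2 *
          (deriv phi t ^ 2 + Real.cos (phi t) ^ 2 * deriv theta t ^ 2) * (4 * Real.pi ^ 2) = 1 := by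
        rw [← hg.unit_speed t]; ring
      by_contra hn
      have : deriv phi t ^ 2 + Real.cos (phi t) ^ 2 * deriv theta t ^ 2 = 0 :=
        le_antisymm (not_lt.mp hn) (by positivity)
      rw [this] at h4
      norm_num at h4
    rw [LinearIndependent.pair_iff]
    intro a b hab
    have e1 := congrArg (fun v => inner ℝ (deriv (fun β => orbitImmersion phi theta β t) α) v) hab
    have e2 := congrArg (fun v => inner ℝ v (deriv (fun s => orbitImmersion phi theta α s) t)) hab
    simp only [inner_add_right, inner_add_left, inner_smul_right, real_inner_smul_left, hF,
      real_inner_self_eq_norm_sq, inner_zero_right, inner_zero_left, mul_zero, add_zero, zero_add,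
      hl] at e1 e2
    have h5 := hc t
    exact ⟨(mul_eq_zero.mp e1).resolve_right (by positivity),
      (mul_eq_zero.mp e2).resolve_right hr.ne'⟩
  · have hdd := (hasDerivAt_deriv_orbitImmersion_right α hp hq (hg.hasDerivAt_deriv_u t)
      (hg.hasDerivAt_deriv_v t)).deriv
    rw [inner_orbitImmersion_left_right hp hq, norm_sq_orbitImmersion_left,
      norm_sq_orbitImmersion_right hp hq, (hasDerivAt_deriv_orbitImmersion_left phi theta α t).deriv,
      hdd]
    rw [(hasDerivAt_orbitImmersion_right α (hp t).hasDerivAt (hq t).hasDerivAt).deriv] at h3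
    rw [inner_fin_five] at h1 h3
    simp only [inner_fin_five w, orbitImmersion, PiLp.toLp_apply, Matrix.cons_val] at h1 h3 ⊢
    have e1 := hg.eq_u t
    have e2 := hg.eq_v t
    rw [(hasDerivAt_cosSq _).deriv, (hasDerivAt_cosSq_mul_cosSq _).deriv] at e1
    rw [(hasDerivAt_cosSq_mul_cosSq _).deriv] at e2
    have hk := hc t
    have hsc := Real.sin_sq_add_cos_sq (phi t)
    generalize deriv (deriv phi) t = p₂ at *
    generalize deriv (deriv theta) t = q₂ at *
    generalize deriv phi t = p₁ at *
    generalize deriv theta t = q₁ at *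
    generalize Real.sin (phi t) = s at *
    generalize Real.cos (phi t) = k at *
    have hp₂ : k * p₂ = s * p₁ ^ 2 - 2 * k ^ 2 * s * q₁ ^ 2 := by
      field_simp at e1
      linear_combination e1 / 8
    have hq₂ : k * q₂ = 4 * s * p₁ * q₁ := by
      field_simp at e2
      linear_combination e2 / 4
    -- X is the component of w along the horizontal direction of J at angle θ, and Y the component
    -- along its θ-derivative.
    obtain ⟨X, hX⟩ : ∃ X, X = Real.sin (theta t) * (Real.cos α * w 0 + Real.sin α * w 1) +
      Real.cos (theta t) * (Real.cos α * w 2 + Real.sin α * w 3) := ⟨_, rfl⟩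
    obtain ⟨Y, hY⟩ : ∃ Y, Y = Real.cos (theta t) * (Real.cos α * w 0 + Real.sin α * w 1) -
      Real.sin (theta t) * (Real.cos α * w 2 + Real.sin α * w 3) := ⟨_, rfl⟩
    have g1 : k * X + s * w 4 = 0 := by rw [hX]; linear_combination h1
    have g3 : p₁ * (-s * X + k * w 4) + k * q₁ * Y = 0 := by
      rw [hX, hY]; linear_combination h3
    have key : (p₁ ^ 2 + k ^ 2 * q₁ ^ 2) * (-k * X) + k ^ 2 * (-(s * p₂ + k * p₁ ^ 2) * X +
        (k * p₂ - s * p₁ ^ 2) * w 4 - 2 * s * p₁ * q₁ * Y + k * q₂ * Y - k * q₁ ^ 2 * X) = 0 := by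
      linear_combination 2 * k * s * p₁ * g3 - 2 * k ^ 2 * p₁ ^ 2 * g1 - 2 * k ^ 4 * q₁ ^ 2 * g1 +
        (w 4 * k ^ 2 - k * s * X) * hp₂ + Y * k ^ 2 * hq₂ + X * (k * p₁ ^ 2 + 2 * k ^ 3 * q₁ ^ 2) * hsc
    rw [hX, hY] at key
    linear_combination key

/-! ### The surfaces as sets -/

lemma rot_point (phi theta : ℝ → ℝ) (α t : ℝ) :
    rot α (point (phi t) (theta t)) = orbitImmersion phi theta α t := by
  ext i
  fin_cases i <;> simp [rot, point, orbitImmersion] <;> ring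

lemma rot_rot (α β : ℝ) (X : EuclideanSpace ℝ (Fin 5)) : rot α (rot β X) = rot (α + β) X := by
  ext i
  fin_cases i <;> simp [rot, Real.cos_add, Real.sin_add] <;> ring

lemma rot_zero (X : EuclideanSpace ℝ (Fin 5)) : rot 0 X = X := by
  ext i
  fin_cases i <;> simp [rot]

lemma orbit_rot (α : ℝ) (X : EuclideanSpace ℝ (Fin 5)) : orbit (rot α X) = orbit X := by
  ext Y
  constructor
  · rintro ⟨β, rfl⟩
    exact ⟨β + α, (rot_rot β α X).symm⟩
  · rintro ⟨β, rfl⟩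
    exact ⟨β - α, by simp only [rot_rot, sub_add_cancel]⟩

theorem IsClosedGeodesic.range_orbitImmersion {phi theta : ℝ → ℝ}
    (h : IsClosedGeodesic phi theta) :
    Set.range (fun z : ℝ × ℝ => orbitImmersion phi theta z.1 z.2) = orbitSurface phi theta := by
  ext X
  constructor
  · rintro ⟨⟨α, t⟩, rfl⟩
    have hc : 0 < Real.cos (phi t) := Real.cos_pos_of_mem_Ioo (h.phi_mem t)
    have hsc := Real.sin_sq_add_cos_sq (phi t)
    refine ⟨⟨h.isMinimalImmersionInSphere.mem_sphere α t, fun e => ?_, fun e => ?_⟩, ?_⟩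
    · have := congrArg (fun v : EuclideanSpace ℝ (Fin 5) => v 4) e
      simp [orbitImmersion] at this
      rw [this] at hsc
      nlinarith
    · have := congrArg (fun v : EuclideanSpace ℝ (Fin 5) => v 4) e
      simp [orbitImmersion] at this
      rw [this] at hsc
      nlinarith
    · refine ⟨_, ⟨t, rfl⟩, ?_⟩
      simp only [← rot_point, orbit_rot]
  · rintro ⟨-, _, ⟨t, rfl⟩, ht⟩
    -- Equal orbits put X itself in the orbit of a point of the curve, which supplies the angle α.
    have : X ∈ orbit X := ⟨0, rot_zero X⟩
    rw [← ht] at this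
    obtain ⟨α, hα⟩ := this
    exact ⟨(α, t), by rw [← hα]; exact (rot_point phi theta α t).symm⟩

lemma equator_injective : Function.Injective equator := by
  intro X Y h
  have hi : ∀ i, equator X i = equator Y i := fun i => by rw [h]
  ext i
  fin_cases i
  · exact hi 1
  · exact hi 3
  · exact hi 2
  · exact hi 4
  · exact hi 5

lemma SameImmersion.range_eq {nu lam phi theta : ℝ → ℝ}
    {I' : ℝ → ℝ → EuclideanSpace ℝ (Fin 4)} (h : SameImmersion nu lam I' phi theta) :
    Set.range (fun z : ℝ × ℝ => wedge (rotationTorus nu lam z.1 z.2) (I' z.1 z.2))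
      = equator '' Set.range (fun z : ℝ × ℝ => orbitImmersion phi theta z.1 z.2) := by
  obtain ⟨τ, -, -, hτ, heq⟩ := h
  ext X
  constructor
  · rintro ⟨⟨α, s⟩, rfl⟩
    obtain ⟨t, rfl⟩ := hτ s
    exact ⟨_, ⟨(α, t), rfl⟩, (heq α t).symm⟩
  · rintro ⟨_, ⟨⟨α, t⟩, rfl⟩, rfl⟩
    exact ⟨(α, τ t), heq α t⟩

/-! ### The function `Omega` -/

/-- The rate of change of the angle `lam` along a geodesic with minimum `a` with respect to the
phase `x` given by `cos (2ν) = cos (2a) cos x`. -/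
noncomputable def phaseRate (a x : ℝ) : ℝ :=
  Real.sin a * Real.cos a / (2 * Real.sqrt ((1 - Real.cos (2 * a) * Real.cos x) / 2) *
    ((1 + Real.cos (2 * a) * Real.cos x) / 2))

lemma cos_two_mul_mem {a : ℝ} (ha : a ∈ Set.Ioo 0 (Real.pi / 4)) : Real.cos (2 * a) ∈ Set.Ioo 0 1 := by
  have h1 : 0 < 2 * a := by linarith [ha.1]
  have h2 : 2 * a < Real.pi / 2 := by linarith [ha.2]
  refine ⟨Real.cos_pos_of_mem_Ioo ⟨by linarith, h2⟩, ?_⟩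
  rw [← Real.cos_zero]
  exact Real.strictAntiOn_cos ⟨le_rfl, Real.pi_pos.le⟩ ⟨h1.le, by linarith [Real.pi_pos]⟩ h1

lemma abs_cos_two_mul_mul_cos_lt_one {a : ℝ} (ha : a ∈ Set.Ioo 0 (Real.pi / 4))
    (x : ℝ) : |Real.cos (2 * a) * Real.cos x| < 1 := by
  obtain ⟨h1, h2⟩ := cos_two_mul_mem ha
  rw [abs_mul, abs_of_pos h1]
  nlinarith [Real.abs_cos_le_one x, abs_nonneg (Real.cos x)]

lemma continuous_phaseRate {a : ℝ} (ha : a ∈ Set.Ioo 0 (Real.pi / 4)) : Continuous (phaseRate a) := by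
  unfold phaseRate
  refine Continuous.div (by fun_prop) (by fun_prop) fun x => ?_
  obtain ⟨h1, h2⟩ := abs_lt.mp (abs_cos_two_mul_mul_cos_lt_one ha x)
  have h3 : 0 < Real.sqrt ((1 - Real.cos (2 * a) * Real.cos x) / 2) :=
    Real.sqrt_pos.mpr (by linarith)
  have h4 : 0 < (1 + Real.cos (2 * a) * Real.cos x) / 2 := by linarith
  positivity

/-- The change of variables cos 2v = cos 2a cos x, from the phase interval between a minimum and the
next maximum of ν. -/
lemma image_arccos_Ioo {a : ℝ} (ha : a ∈ Set.Ioo 0 (Real.pi / 4)) :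
    (fun x => Real.arccos (Real.cos (2 * a) * Real.cos x) / 2) '' Set.Ioo 0 Real.pi
      = Set.Ioo a (Real.pi / 2 - a) := by
  obtain ⟨h1, h2⟩ := cos_two_mul_mem ha
  have h3 : Real.arccos (Real.cos (2 * a)) = 2 * a :=
    Real.arccos_cos (by linarith [ha.1]) (by linarith [ha.2, Real.pi_pos])
  ext v
  constructor
  · rintro ⟨x, hx, rfl⟩
    have hc1 : Real.cos x < 1 := by
      rw [← Real.cos_zero]
      exact Real.strictAntiOn_cos ⟨le_rfl, Real.pi_pos.le⟩ ⟨hx.1.le, hx.2.le⟩ hx.1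
    have hc2 : -1 < Real.cos x := by
      rw [← Real.cos_pi]
      exact Real.strictAntiOn_cos ⟨hx.1.le, hx.2.le⟩ ⟨Real.pi_pos.le, le_rfl⟩ hx.2
    have k1 : Real.arccos (Real.cos (2 * a)) < Real.arccos (Real.cos (2 * a) * Real.cos x) :=
      Real.strictAntiOn_arccos ⟨by nlinarith, by nlinarith⟩ ⟨by linarith, h2.le⟩ (by nlinarith)
    have k2 : Real.arccos (Real.cos (2 * a) * Real.cos x) < Real.arccos (-Real.cos (2 * a)) :=
      Real.strictAntiOn_arccos ⟨by linarith, by linarith⟩ ⟨by nlinarith, by nlinarith⟩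
        (by nlinarith)
    rw [Real.arccos_neg] at k2
    rw [h3] at k1 k2
    constructor <;> simp only <;> linarith
  · rintro ⟨hv1, hv2⟩
    have h0 := ha.1
    have k1 : Real.cos (2 * v) < Real.cos (2 * a) :=
      Real.strictAntiOn_cos ⟨by linarith, by linarith⟩ ⟨by linarith, by linarith⟩ (by linarith)
    have k2 : -Real.cos (2 * a) < Real.cos (2 * v) := by
      rw [← Real.cos_pi_sub]
      exact Real.strictAntiOn_cos ⟨by linarith, by linarith⟩ ⟨by linarith, by linarith⟩
        (by linarith)
    have k3 : -1 < Real.cos (2 * v) / Real.cos (2 * a) := by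
      rw [lt_div_iff₀ h1]; linarith
    have k4 : Real.cos (2 * v) / Real.cos (2 * a) < 1 := by
      rw [div_lt_iff₀ h1]; linarith
    refine ⟨Real.arccos (Real.cos (2 * v) / Real.cos (2 * a)), ⟨Real.arccos_pos.mpr k4, ?_⟩, ?_⟩
    · refine lt_of_le_of_ne (Real.arccos_le_pi _) fun e => ?_
      rw [Real.arccos_eq_pi] at e
      linarith
    · simp only
      rw [Real.cos_arccos k3.le k4.le, mul_div_cancel₀ _ h1.ne',
        Real.arccos_cos (by linarith) (by linarith)]
      ring

/-- Under cos 2v = cos 2a cos x the singular square root becomes cos 2a sin x / 2, and its zeros at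
the ends cancel against the factor sin x of dv/dx. The integrand becomes continuous. -/
theorem Omega_eq_integral_phaseRate {a : ℝ} (ha : a ∈ Set.Ioo 0 (Real.pi / 4)) : Omega a = ∫ x in (0 : ℝ)..Real.pi, phaseRate a x := by
  obtain ⟨h1, h2⟩ := cos_two_mul_mem ha
  have hd : ∀ x ∈ Set.Ioo 0 Real.pi,
      HasDerivWithinAt (fun x => Real.arccos (Real.cos (2 * a) * Real.cos x) / 2)
        (Real.cos (2 * a) * Real.sin x /
          (2 * Real.sqrt (1 - (Real.cos (2 * a) * Real.cos x) ^ 2))) (Set.Ioo 0 Real.pi) x := by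
    intro x _
    obtain ⟨k1, k2⟩ := abs_lt.mp (abs_cos_two_mul_mul_cos_lt_one ha x)
    refine HasDerivAt.hasDerivWithinAt ?_
    refine (((Real.hasDerivAt_arccos k1.ne' k2.ne).comp x
      ((Real.hasDerivAt_cos x).const_mul (Real.cos (2 * a)))).div_const 2).congr_deriv ?_
    have : 0 < Real.sqrt (1 - (Real.cos (2 * a) * Real.cos x) ^ 2) :=
      Real.sqrt_pos.mpr (by nlinarith)
    field_simp
  have hinj : Set.InjOn (fun x => Real.arccos (Real.cos (2 * a) * Real.cos x) / 2)
      (Set.Ioo 0 Real.pi) := by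
    intro x hx y hy hxy
    obtain ⟨k1, k2⟩ := abs_lt.mp (abs_cos_two_mul_mul_cos_lt_one ha x)
    obtain ⟨k3, k4⟩ := abs_lt.mp (abs_cos_two_mul_mul_cos_lt_one ha y)
    have e1 : Real.arccos (Real.cos (2 * a) * Real.cos x) =
        Real.arccos (Real.cos (2 * a) * Real.cos y) := by
      simp only at hxy; linarith
    have e2 := Real.arccos_injOn ⟨k1.le, k2.le⟩ ⟨k3.le, k4.le⟩ e1
    exact Real.injOn_cos ⟨hx.1.le, hx.2.le⟩ ⟨hy.1.le, hy.2.le⟩ (mul_left_cancel₀ h1.ne' e2)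
  rw [Omega, intervalIntegral.integral_of_le (by linarith [ha.2]),
    intervalIntegral.integral_of_le Real.pi_pos.le,
    MeasureTheory.integral_Ioc_eq_integral_Ioo, MeasureTheory.integral_Ioc_eq_integral_Ioo,
    ← image_arccos_Ioo ha,
    MeasureTheory.integral_image_eq_integral_abs_deriv_smul measurableSet_Ioo hd hinj,
    ← MeasureTheory.integral_const_mul]
  refine MeasureTheory.setIntegral_congr_fun measurableSet_Ioo fun x hx => ?_
  obtain ⟨k1, k2⟩ := abs_lt.mp (abs_cos_two_mul_mul_cos_lt_one ha x)
  have hsx : 0 < Real.sin x := Real.sin_pos_of_pos_of_lt_pi hx.1 hx.2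
  have hsin2a : Real.sin a ^ 2 * Real.cos a ^ 2 = (1 - Real.cos (2 * a) ^ 2) / 4 := by
    have := Real.sin_sq_add_cos_sq a
    rw [Real.cos_two_mul, Real.sin_sq]; ring
  have hscx := Real.sin_sq_add_cos_sq x
  obtain ⟨v, hv⟩ : ∃ v, v = Real.arccos (Real.cos (2 * a) * Real.cos x) / 2 := ⟨_, rfl⟩
  have hcos : Real.cos (2 * v) = Real.cos (2 * a) * Real.cos x := by
    rw [hv, mul_div_cancel₀ _ two_ne_zero, Real.cos_arccos k1.le k2.le]
  have hv0 : 0 < v := by rw [hv]; have := Real.arccos_pos.mpr k2; linarith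
  have hv1 : v < Real.pi / 2 := by
    have : Real.arccos (Real.cos (2 * a) * Real.cos x) < Real.pi := by
      refine lt_of_le_of_ne (Real.arccos_le_pi _) fun e => ?_
      rw [Real.arccos_eq_pi] at e
      linarith
    linarith
  have hsv : 0 < Real.sin v := Real.sin_pos_of_pos_of_lt_pi hv0 (by linarith [Real.pi_pos])
  have hcv : 0 < Real.cos v := Real.cos_pos_of_mem_Ioo ⟨by linarith [Real.pi_pos], hv1⟩
  have hscv := Real.sin_sq_add_cos_sq v
  have hcv2 : (1 + Real.cos (2 * a) * Real.cos x) / 2 = Real.cos v ^ 2 := by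
    rw [← hcos, Real.cos_two_mul]; ring
  have hsv2 : (1 - Real.cos (2 * a) * Real.cos x) / 2 = Real.sin v ^ 2 := by
    rw [← hcos, Real.cos_two_mul]; linear_combination -hscv
  have hs1 : Real.sqrt (1 - (Real.cos (2 * a) * Real.cos x) ^ 2)
      = 2 * Real.sin v * Real.cos v := by
    rw [Real.sqrt_eq_iff_mul_self_eq (by nlinarith) (by positivity)]
    rw [show 1 - (Real.cos (2 * a) * Real.cos x) ^ 2 = 4 * ((1 - Real.cos (2 * a) * Real.cos x) / 2)
      * ((1 + Real.cos (2 * a) * Real.cos x) / 2) by ring, hcv2, hsv2]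
    ring
  have hs2 : Real.sqrt (Real.sin v ^ 2 * Real.cos v ^ 2 - Real.sin a ^ 2 * Real.cos a ^ 2)
      = Real.cos (2 * a) * Real.sin x / 2 := by
    have e : Real.sin v ^ 2 * Real.cos v ^ 2 - Real.sin a ^ 2 * Real.cos a ^ 2
        = (Real.cos (2 * a) * Real.sin x / 2) ^ 2 := by
      rw [hsin2a, ← hsv2, ← hcv2]
      linear_combination (-Real.cos (2 * a) ^ 2 / 4) * hscx
    rw [e, Real.sqrt_sq (by positivity)]
  simp only [smul_eq_mul, phaseRate, ← hv]
  rw [hs1, hs2, hcv2, hsv2, Real.sqrt_sq hsv.le, abs_of_pos (by positivity)]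
  field_simp

lemma integral_inv_one_sub_sq {a : ℝ} (ha : a ∈ Set.Ioo 0 (Real.pi / 4)) :
    ∫ x in (0 : ℝ)..Real.pi, 1 / (1 - (Real.cos (2 * a) * Real.cos x) ^ 2)
      = Real.pi / Real.sin (2 * a) := by
  have hS : 0 < Real.sin (2 * a) :=
    Real.sin_pos_of_pos_of_lt_pi (by linarith [ha.1]) (by linarith [ha.2, Real.pi_pos])
  have hSC := Real.sin_sq_add_cos_sq (2 * a)
  have hden : ∀ x, 0 < Real.sin (2 * a) * Real.cos x ^ 2 + Real.sin x ^ 2 := fun x => by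
    have := Real.sin_sq_add_cos_sq x
    rcases eq_or_ne (Real.cos x) 0 with h0 | h0
    · rw [h0] at this ⊢; nlinarith
    · have : 0 < Real.cos x ^ 2 := by positivity
      positivity
  -- The denominator is sin² x + S² cos² x with S = sin 2a, so arctan(tan x / S)/S is a local
  -- primitive. Writing it as x plus the arctangent of the tangent of the difference removes the
  -- jump at π/2.
  have hd : ∀ x, HasDerivAt (fun x => (x + Real.arctan ((1 - Real.sin (2 * a)) *
        (Real.sin x * Real.cos x) / (Real.sin (2 * a) * Real.cos x ^ 2 + Real.sin x ^ 2)))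
          / Real.sin (2 * a))
      (1 / (1 - (Real.cos (2 * a) * Real.cos x) ^ 2)) x := fun x => by
    have hs := Real.hasDerivAt_sin x
    have hc := Real.hasDerivAt_cos x
    have h1 := ((hasDerivAt_id x).add (((hs.mul hc).const_mul (1 - Real.sin (2 * a))).div
      (((hc.pow 2).const_mul (Real.sin (2 * a))).add (hs.pow 2)) (hden x).ne').arctan).div_const
        (Real.sin (2 * a))
    refine h1.congr_deriv ?_
    have hsc := Real.sin_sq_add_cos_sq x
    have hdx := hden x
    have hx : 0 < 1 - (Real.cos (2 * a) * Real.cos x) ^ 2 := by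
      have := abs_lt.mp (abs_cos_two_mul_mul_cos_lt_one ha x); nlinarith
    simp only [Pi.mul_apply, Pi.pow_apply, Pi.add_apply, Pi.div_apply]
    push_cast
    simp only [pow_one]
    generalize Real.sin (2 * a) = S at *
    generalize Real.cos (2 * a) = C at *
    generalize Real.sin x = s at *
    generalize Real.cos x = c at *
    have hD : (S * c ^ 2 + s ^ 2) ^ 2 + ((1 - S) * (s * c)) ^ 2 = 1 - (C * c) ^ 2 := by
      linear_combination (S ^ 2 * c ^ 2 + s ^ 2 + 1) * hsc + c ^ 2 * hSC
    have hN : (1 - S) * (c * c + s * -s) * (S * c ^ 2 + s ^ 2) - (1 - S) * (s * c) *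
        (S * (2 * c * -s) + 2 * s * c) = S - (1 - (C * c) ^ 2) := by
      linear_combination ((1 - S) * (S * c ^ 2 - s ^ 2) + S - 1) * hsc - c ^ 2 * hSC
    have hA : 1 + ((1 - S) * (s * c) / (S * c ^ 2 + s ^ 2)) ^ 2
        = (1 - (C * c) ^ 2) / (S * c ^ 2 + s ^ 2) ^ 2 := by
      rw [← hD]; field_simp
    rw [hA, hN]
    generalize 1 - (C * c) ^ 2 = D at *
    field_simp
    ring
  rw [intervalIntegral.integral_eq_sub_of_hasDerivAt (fun x _ => hd x)]
  · simp
  · refine Continuous.intervalIntegrable ?_ _ _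
    refine Continuous.div (by fun_prop) (by fun_prop) fun x => ?_
    have := abs_lt.mp (abs_cos_two_mul_mul_cos_lt_one ha x)
    nlinarith

/-- The reflection x ↦ π - x exchanges p = sin ν and q = cos ν. The sum of 1/(pq²) and 1/(p²q) is (p
+ q)/(p²q²), and 4p²q² = 1 - cos² 2a cos² x. -/
lemma phaseRate_add_phaseRate_pi_sub {a : ℝ} (ha : a ∈ Set.Ioo 0 (Real.pi / 4)) (x : ℝ) :
    phaseRate a x + phaseRate a (Real.pi - x) =
      Real.sin (2 * a) * (Real.sqrt ((1 - Real.cos (2 * a) * Real.cos x) / 2) +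
        Real.sqrt ((1 + Real.cos (2 * a) * Real.cos x) / 2)) *
        (1 / (1 - (Real.cos (2 * a) * Real.cos x) ^ 2)) := by
  obtain ⟨h1, h2⟩ := abs_lt.mp (abs_cos_two_mul_mul_cos_lt_one ha x)
  rw [phaseRate, phaseRate, Real.cos_pi_sub, Real.sin_two_mul, mul_neg]
  generalize Real.cos (2 * a) * Real.cos x = w at *
  have hp : 0 < Real.sqrt ((1 - w) / 2) := Real.sqrt_pos.mpr (by linarith)
  have hq : 0 < Real.sqrt ((1 + w) / 2) := Real.sqrt_pos.mpr (by linarith)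
  have hp2 : (1 - w) / 2 = Real.sqrt ((1 - w) / 2) ^ 2 := (Real.sq_sqrt (by linarith)).symm
  have hq2 : (1 + w) / 2 = Real.sqrt ((1 + w) / 2) ^ 2 := (Real.sq_sqrt (by linarith)).symm
  rw [sub_neg_eq_add, ← sub_eq_add_neg]
  have hw : 1 - w ^ 2 = 4 * Real.sqrt ((1 - w) / 2) ^ 2 * Real.sqrt ((1 + w) / 2) ^ 2 := by
    rw [← hp2, ← hq2]; ring
  rw [hw]
  generalize Real.sqrt ((1 - w) / 2) = p at *
  generalize Real.sqrt ((1 + w) / 2) = q at *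
  rw [hp2, hq2]
  field_simp
  ring

/-- The two roots are positive with squares summing to 1, so the square of their sum exceeds 1 by
twice their product. -/
lemma one_lt_sqrt_add_sqrt {w : ℝ} (h1 : -1 < w) (h2 : w < 1) :
    1 < Real.sqrt ((1 - w) / 2) + Real.sqrt ((1 + w) / 2) := by
  have hp : 0 < Real.sqrt ((1 - w) / 2) := Real.sqrt_pos.mpr (by linarith)
  have hq : 0 < Real.sqrt ((1 + w) / 2) := Real.sqrt_pos.mpr (by linarith)
  have hp2 : Real.sqrt ((1 - w) / 2) ^ 2 = (1 - w) / 2 := Real.sq_sqrt (by linarith)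
  have hq2 : Real.sqrt ((1 + w) / 2) ^ 2 = (1 + w) / 2 := Real.sq_sqrt (by linarith)
  nlinarith [mul_pos hp hq]

lemma sqrt_add_sqrt_le {w : ℝ} (h1 : -1 < w) (h2 : w < 1) :
    Real.sqrt ((1 - w) / 2) + Real.sqrt ((1 + w) / 2) ≤ Real.sqrt 2 := by
  have hp2 : Real.sqrt ((1 - w) / 2) ^ 2 = (1 - w) / 2 := Real.sq_sqrt (by linarith)
  have hq2 : Real.sqrt ((1 + w) / 2) ^ 2 = (1 + w) / 2 := Real.sq_sqrt (by linarith)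
  apply Real.le_sqrt_of_sq_le
  nlinarith [sq_nonneg (Real.sqrt ((1 - w) / 2) - Real.sqrt ((1 + w) / 2))]

lemma sqrt_add_sqrt_lt {w : ℝ} (h1 : -1 < w) (h2 : w < 1) (h : w ≠ 0) :
    Real.sqrt ((1 - w) / 2) + Real.sqrt ((1 + w) / 2) < Real.sqrt 2 := by
  have hp2 : Real.sqrt ((1 - w) / 2) ^ 2 = (1 - w) / 2 := Real.sq_sqrt (by linarith)
  have hq2 : Real.sqrt ((1 + w) / 2) ^ 2 = (1 + w) / 2 := Real.sq_sqrt (by linarith)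
  have hne : Real.sqrt ((1 - w) / 2) - Real.sqrt ((1 + w) / 2) ≠ 0 := fun e => by
    rw [sub_eq_zero.mp e] at hp2
    exact h (by linarith)
  apply Real.lt_sqrt_of_sq_lt
  have : 0 < (Real.sqrt ((1 - w) / 2) - Real.sqrt ((1 + w) / 2)) ^ 2 := by positivity
  nlinarith

/-- The rotation angle of an Otsuki geodesic lies strictly between `π / 2` and `π / √2`. -/
theorem Omega_mem {a : ℝ} (ha : a ∈ Set.Ioo 0 (Real.pi / 4)) :
    Omega a ∈ Set.Ioo (Real.pi / 2) (Real.sqrt 2 / 2 * Real.pi) := by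
  have hS : 0 < Real.sin (2 * a) :=
    Real.sin_pos_of_pos_of_lt_pi (by linarith [ha.1]) (by linarith [ha.2, Real.pi_pos])
  have hcont := continuous_phaseRate ha
  have hw := fun x => abs_lt.mp (abs_cos_two_mul_mul_cos_lt_one ha x)
  have hsym : 2 * Omega a = ∫ x in (0 : ℝ)..Real.pi, (phaseRate a x + phaseRate a (Real.pi - x)) := by
    have hcont' : Continuous fun x => phaseRate a (Real.pi - x) :=
      hcont.comp (continuous_sub_left _)
    rw [intervalIntegral.integral_add (hcont.intervalIntegrable _ _) (hcont'.intervalIntegrable _ _),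
      intervalIntegral.integral_comp_sub_left, sub_self, sub_zero, ← Omega_eq_integral_phaseRate ha]
    ring
  have hpos : ∀ x, 0 < 1 / (1 - (Real.cos (2 * a) * Real.cos x) ^ 2) := fun x => by
    have := hw x
    apply one_div_pos.mpr
    nlinarith
  have hcont1 : Continuous fun x => phaseRate a x + phaseRate a (Real.pi - x) :=
    hcont.add (hcont.comp (continuous_sub_left _))
  have hcont2 : Continuous fun x => 1 / (1 - (Real.cos (2 * a) * Real.cos x) ^ 2) := by
    refine Continuous.div (by fun_prop) (by fun_prop) fun x => ?_
    exact (one_div_pos.mp (hpos x)).ne'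
  have hint : ∀ k : ℝ, ∫ x in (0 : ℝ)..Real.pi,
      Real.sin (2 * a) * k * (1 / (1 - (Real.cos (2 * a) * Real.cos x) ^ 2)) = k * Real.pi := by
    intro k
    rw [intervalIntegral.integral_const_mul, integral_inv_one_sub_sq ha]
    field_simp
  have lower : 1 * Real.pi < 2 * Omega a := by
    rw [hsym, ← hint 1]
    have hlt : ∀ x, Real.sin (2 * a) * 1 * (1 / (1 - (Real.cos (2 * a) * Real.cos x) ^ 2)) <
        phaseRate a x + phaseRate a (Real.pi - x) := fun x => by
      rw [phaseRate_add_phaseRate_pi_sub ha]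
      exact mul_lt_mul_of_pos_right
        (mul_lt_mul_of_pos_left (one_lt_sqrt_add_sqrt (hw x).1 (hw x).2) hS) (hpos x)
    exact intervalIntegral.integral_lt_integral_of_continuousOn_of_le_of_exists_lt Real.pi_pos
      (continuous_const.mul hcont2).continuousOn hcont1.continuousOn (fun x _ => (hlt x).le)
      ⟨0, ⟨le_rfl, Real.pi_pos.le⟩, hlt 0⟩
  -- The upper estimate is an equality where cos x = 0, so strictness is taken at x = 0, where cos
  -- 2a cos x = cos 2a ≠ 0.
  have upper : 2 * Omega a < Real.sqrt 2 * Real.pi := by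
    rw [hsym, ← hint (Real.sqrt 2)]
    refine intervalIntegral.integral_lt_integral_of_continuousOn_of_le_of_exists_lt Real.pi_pos
      hcont1.continuousOn (continuous_const.mul hcont2).continuousOn (fun x _ => ?_)
      ⟨0, ⟨le_rfl, Real.pi_pos.le⟩, ?_⟩
    · rw [phaseRate_add_phaseRate_pi_sub ha]
      exact mul_le_mul_of_nonneg_right
        (mul_le_mul_of_nonneg_left (sqrt_add_sqrt_le (hw x).1 (hw x).2) hS.le) (hpos x).le
    · rw [phaseRate_add_phaseRate_pi_sub ha]
      refine mul_lt_mul_of_pos_right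
        (mul_lt_mul_of_pos_left (sqrt_add_sqrt_lt (hw 0).1 (hw 0).2 ?_) hS) (hpos 0)
      rw [Real.cos_zero, mul_one]
      exact (cos_two_mul_mem ha).1.ne'
  constructor <;> linarith

/-! ### Closed geodesics have a rational rotation angle -/

lemma phaseRate_periodic (a : ℝ) : Function.Periodic (phaseRate a) (2 * Real.pi) := fun x => by
  rw [phaseRate, phaseRate, Real.cos_add_two_pi]

/-- A full phase period consists of a half from minimum to maximum and its mirror image under x ↦ 2π
- x; each contributes Ω(a). -/
theorem integral_phaseRate_add_zsmul {a : ℝ} (ha : a ∈ Set.Ioo 0 (Real.pi / 4)) (n : ℤ)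
    (x : ℝ) : ∫ u in x..x + n • (2 * Real.pi), phaseRate a u = n * (2 * Omega a) := by
  have hcont := continuous_phaseRate ha
  have h2 : ∫ u in Real.pi..2 * Real.pi, phaseRate a u = Omega a := by
    have := intervalIntegral.integral_comp_sub_left (a := 0) (b := Real.pi) (phaseRate a)
      (2 * Real.pi)
    rw [show 2 * Real.pi - Real.pi = Real.pi by ring, sub_zero] at this
    rw [← this, Omega_eq_integral_phaseRate ha]
    congr 1
    funext u
    rw [phaseRate, phaseRate, Real.cos_two_pi_sub]
  rw [(phaseRate_periodic a).intervalIntegral_add_zsmul_eq n x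
    (fun t₁ t₂ => hcont.intervalIntegrable t₁ t₂),
    (phaseRate_periodic a).intervalIntegral_add_eq x 0, zero_add,
    ← intervalIntegral.integral_add_adjacent_intervals (hcont.intervalIntegrable 0 Real.pi)
      (hcont.intervalIntegrable _ _), h2, ← Omega_eq_integral_phaseRate ha, zsmul_eq_mul]
  ring

lemma exists_angle {X Y R : ℝ} (hR : 0 < R) (h : X ^ 2 + Y ^ 2 = R ^ 2) :
    ∃ ψ, X = R * Real.cos ψ ∧ Y = R * Real.sin ψ := by
  have hn : ‖(⟨X, Y⟩ : ℂ)‖ = R := by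
    rw [← sq_eq_sq₀ (norm_nonneg _) hR.le, Complex.sq_norm, Complex.normSq_mk, ← h]; ring
  refine ⟨Complex.arg ⟨X, Y⟩, ?_, ?_⟩
  · rw [← hn, Complex.norm_mul_cos_arg]
  · rw [← hn, Complex.norm_mul_sin_arg]

/-- The phase of a solution. -/
theorem ToricSystem.exists_phase {c a : ℝ} {z z₁ lam : ℝ → ℝ} (h : ToricSystem c z z₁ lam)
    (ha : a ∈ Set.Ioo 0 (Real.pi / 4)) (hca : c ^ 2 = (Real.sin a * Real.cos a) ^ 2) :
    ∃ ψ : ℝ → ℝ, (∀ t, HasDerivAt ψ (1 / (Real.pi * Real.sqrt (z t))) t) ∧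
      (∀ t, 1 - 2 * z t = Real.cos (2 * a) * Real.cos (ψ t)) ∧
      ∀ t, 2 * Real.pi * Real.sqrt (z t) * z₁ t = Real.cos (2 * a) * Real.sin (ψ t) := by
  have hp := Real.pi_pos
  have hR := (cos_two_mul_mem ha).1
  have hca' : 4 * c ^ 2 = 1 - Real.cos (2 * a) ^ 2 := by
    rw [hca, Real.cos_two_mul]
    linear_combination (4 * Real.cos a ^ 2) * Real.sin_sq_add_cos_sq a
  have hsqrt : ∀ t, 0 < Real.sqrt (z t) := fun t => Real.sqrt_pos.mpr (h.pos t)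
  have hsq : ∀ t, Real.sqrt (z t) ^ 2 = z t := fun t => Real.sq_sqrt (h.pos t).le
  have hcz : Continuous z := continuous_iff_continuousAt.mpr fun t => (h.hasDerivAt t).continuousAt
  have hcg : Continuous fun t => 1 / (Real.pi * Real.sqrt (z t)) :=
    continuous_const.div (continuous_const.mul hcz.sqrt) fun t => (mul_pos hp (hsqrt t)).ne'
  -- The energy equation places (1 - 2z, 2π√z z₁) on the circle of radius cos 2a; by `hX` and `hY`
  -- the point turns with angular speed 1/(π√z).
  have hcirc : ∀ t, (1 - 2 * z t) ^ 2 + (2 * Real.pi * Real.sqrt (z t) * z₁ t) ^ 2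
      = Real.cos (2 * a) ^ 2 := fun t => by
    have he := h.energy t
    have hz := h.pos t
    have : c ^ 2 / z t * z t = c ^ 2 := by field_simp
    linear_combination 4 * Real.pi ^ 2 * z₁ t ^ 2 * hsq t + 4 * z t * he - 4 * this - hca'
  obtain ⟨ψ₀, hX₀, hY₀⟩ := exists_angle hR (hcirc 0)
  obtain ⟨ψ, hψdef⟩ : ∃ ψ : ℝ → ℝ, ψ = fun t => ψ₀ + ∫ u in (0 : ℝ)..t,
      1 / (Real.pi * Real.sqrt (z u)) := ⟨_, rfl⟩
  have hψ : ∀ t, HasDerivAt ψ (1 / (Real.pi * Real.sqrt (z t))) t := fun t => by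
    rw [hψdef]
    exact (hcg.integral_hasStrictDerivAt 0 t).hasDerivAt.const_add ψ₀
  have hψ0 : ψ 0 = ψ₀ := by rw [hψdef]; simp
  have hX : ∀ t, HasDerivAt (fun t => 1 - 2 * z t)
      (-(2 * Real.pi * Real.sqrt (z t) * z₁ t) * (1 / (Real.pi * Real.sqrt (z t)))) t := fun t => by
    refine (((h.hasDerivAt t).const_mul 2).const_sub 1).congr_deriv ?_
    have := hsqrt t
    field_simp
  have hY : ∀ t, HasDerivAt (fun t => 2 * Real.pi * Real.sqrt (z t) * z₁ t)
      ((1 - 2 * z t) * (1 / (Real.pi * Real.sqrt (z t)))) t := fun t => by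
    refine ((((h.hasDerivAt t).sqrt (h.pos t).ne').const_mul (2 * Real.pi)).mul
      (h.hasDerivAt' t)).congr_deriv ?_
    have h1 := hsqrt t
    have h2 := hsq t
    have he := h.energy t
    generalize Real.sqrt (z t) = r at *
    rw [← h2] at he ⊢
    field_simp at he ⊢
    linear_combination he
  -- U and V are the coordinates of the moving point turned back by ψ; they are constant.
  have hU : ∀ t, (1 - 2 * z t) * Real.cos (ψ t)
      + 2 * Real.pi * Real.sqrt (z t) * z₁ t * Real.sin (ψ t) = Real.cos (2 * a) := fun t => by
    have hd : ∀ t, HasDerivAt (fun t => (1 - 2 * z t) * Real.cos (ψ t)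
      + 2 * Real.pi * Real.sqrt (z t) * z₁ t * Real.sin (ψ t)) 0 t := fun t =>
      (((hX t).mul (hψ t).cos).add ((hY t).mul (hψ t).sin)).congr_deriv (by ring)
    have := is_const_of_deriv_eq_zero (fun t => (hd t).differentiableAt) (fun t => (hd t).deriv) t 0
    rw [this, hψ0, hX₀, hY₀]
    linear_combination Real.cos (2 * a) * Real.sin_sq_add_cos_sq ψ₀
  have hV : ∀ t, -(1 - 2 * z t) * Real.sin (ψ t)
      + 2 * Real.pi * Real.sqrt (z t) * z₁ t * Real.cos (ψ t) = 0 := fun t => by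
    have hd : ∀ t, HasDerivAt (fun t => -(1 - 2 * z t) * Real.sin (ψ t)
      + 2 * Real.pi * Real.sqrt (z t) * z₁ t * Real.cos (ψ t)) 0 t := fun t =>
      (((hX t).neg.mul (hψ t).sin).add ((hY t).mul (hψ t).cos)).congr_deriv
        (by simp only [Pi.neg_apply]; ring)
    have := is_const_of_deriv_eq_zero (fun t => (hd t).differentiableAt) (fun t => (hd t).deriv) t 0
    rw [this, hψ0, hX₀, hY₀]
    ring
  refine ⟨ψ, hψ, fun t => ?_, fun t => ?_⟩
  · linear_combination Real.cos (ψ t) * hU t - Real.sin (ψ t) * hV t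
      - (1 - 2 * z t) * Real.sin_sq_add_cos_sq (ψ t)
  · linear_combination Real.sin (ψ t) * hU t + Real.cos (ψ t) * hV t
      - (2 * Real.pi * Real.sqrt (z t) * z₁ t) * Real.sin_sq_add_cos_sq (ψ t)

/-- Over one period the phase advances by 2πn with n > 0, so λ advances by ±2nΩ(a). Closedness makes
this 2πm, whence Ω(a) = π|m|/n. -/
theorem ToricSystem.exists_Omega_eq {c a T : ℝ} {m : ℤ} {z z₁ lam : ℝ → ℝ}
    (h : ToricSystem c z z₁ lam) (ha : a ∈ Set.Ioo 0 (Real.pi / 4))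
    (hca : |c| = Real.sin a * Real.cos a) (hT : 0 < T) (hz : z T = z 0) (hz₁ : z₁ T = z₁ 0)
    (hlam : lam T = lam 0 + 2 * Real.pi * m) :
    ∃ p q : ℕ, 0 < q ∧ Omega a = (p : ℝ) / q * Real.pi := by
  have hp := Real.pi_pos
  have hR := (cos_two_mul_mem ha).1
  obtain ⟨ψ, hψ, hX, hY⟩ := h.exists_phase ha (by rw [← hca, sq_abs])
  have hsqrt : ∀ t, 0 < Real.sqrt (z t) := fun t => Real.sqrt_pos.mpr (h.pos t)
  have hcz : Continuous z := continuous_iff_continuousAt.mpr fun t => (h.hasDerivAt t).continuousAt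
  have hcψ : Continuous ψ := continuous_iff_continuousAt.mpr fun t => (hψ t).continuousAt
  have hcg : Continuous fun t => 1 / (Real.pi * Real.sqrt (z t)) :=
    continuous_const.div (continuous_const.mul hcz.sqrt) fun t => (mul_pos hp (hsqrt t)).ne'
  have hmono : ψ 0 < ψ T :=
    strictMono_of_deriv_pos (fun t => by rw [(hψ t).deriv]; have := hsqrt t; positivity) hT
  have hcos : Real.cos (ψ T) = Real.cos (ψ 0) :=
    mul_left_cancel₀ hR.ne' (by rw [← hX, ← hX, hz])
  have hsin : Real.sin (ψ T) = Real.sin (ψ 0) :=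
    mul_left_cancel₀ hR.ne' (by rw [← hY, ← hY, hz, hz₁])
  obtain ⟨n, hn⟩ := Real.Angle.angle_eq_iff_two_pi_dvd_sub.mp (Real.Angle.cos_sin_inj hcos hsin)
  have hn0 : 0 < n := by
    have : 0 < 2 * Real.pi * (n : ℝ) := by rw [← hn]; linarith
    exact_mod_cast (pos_iff_pos_of_mul_pos this).mp (by positivity)
  have hψT : ψ T = ψ 0 + n • (2 * Real.pi) := by rw [zsmul_eq_mul]; linarith
  -- `phaseRate` is positive, so the direction of rotation of λ enters as the sign s of c.
  obtain ⟨s, hs, hsc⟩ : ∃ s : ℝ, |s| = 1 ∧ c = s * |c| := by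
    rcases le_total 0 c with h0 | h0
    · exact ⟨1, by norm_num, by rw [abs_of_nonneg h0]; ring⟩
    · exact ⟨-1, by norm_num, by rw [abs_of_nonpos h0]; ring⟩
  have hrate : ∀ t, c / (2 * Real.pi * z t * (1 - z t))
      = s * ((phaseRate a ∘ ψ) t * (1 / (Real.pi * Real.sqrt (z t)))) := fun t => by
    have h1 : (1 - Real.cos (2 * a) * Real.cos (ψ t)) / 2 = z t := by rw [← hX]; ring
    have h2 : (1 + Real.cos (2 * a) * Real.cos (ψ t)) / 2 = 1 - z t := by rw [← hX]; ring
    have h3 : 0 < 1 - z t := by linarith [h.lt_one t]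
    have h4 := hsqrt t
    have h5 : Real.sqrt (z t) ^ 2 = z t := Real.sq_sqrt (h.pos t).le
    rw [Function.comp, phaseRate, h1, h2, ← hca]
    nth_rewrite 1 [hsc, ← h5]
    field_simp
  have hint : s * ∫ t in (0 : ℝ)..T, (phaseRate a ∘ ψ) t * (1 / (Real.pi * Real.sqrt (z t)))
      = 2 * Real.pi * m := by
    rw [← intervalIntegral.integral_const_mul,
      intervalIntegral.integral_eq_sub_of_hasDerivAt (f := lam)
        (fun t _ => (h.hasDerivAt_angle t).congr_deriv (hrate t)), hlam]
    · ring
    · exact (continuous_const.mul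
        (((continuous_phaseRate ha).comp hcψ).mul hcg)).intervalIntegrable _ _
  rw [intervalIntegral.integral_comp_mul_deriv (fun t _ => hψ t) hcg.continuousOn
    (continuous_phaseRate ha), hψT, integral_phaseRate_add_zsmul ha] at hint
  have hΩ : 0 < Omega a := by linarith [(Omega_mem ha).1]
  have hn0' : (0 : ℝ) < n := by exact_mod_cast hn0
  have habs := congrArg abs hint
  rw [abs_mul, hs, abs_of_pos (by positivity : (0 : ℝ) < n * (2 * Omega a)), abs_mul,
    abs_of_pos (by positivity : (0 : ℝ) < 2 * Real.pi)] at habs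
  refine ⟨m.natAbs, n.natAbs, Int.natAbs_pos.mpr hn0.ne', ?_⟩
  rw [Nat.cast_natAbs, Nat.cast_natAbs, abs_of_pos hn0]
  push_cast
  field_simp
  linarith

/-- The energy equation confines z to the interval from sin² a to cos² a. A periodic z attains its
minimum, where z₁ = 0, so the minimum is an endpoint. -/
theorem ToricSystem.isLeast {c a T : ℝ} {z z₁ lam : ℝ → ℝ} (h : ToricSystem c z z₁ lam)
    (ha : a ∈ Set.Ioo 0 (Real.pi / 4)) (hca : |c| = Real.sin a * Real.cos a) (hT : 0 < T)
    (hz : Function.Periodic z T) : IsLeast (Set.range z) (Real.sin a ^ 2) := by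
  have hp := Real.pi_pos
  have hsa : 0 < Real.sin a := Real.sin_pos_of_pos_of_lt_pi ha.1 (by linarith [ha.2])
  have hlt : Real.sin a ^ 2 < Real.cos a ^ 2 := by
    have := (cos_two_mul_mem ha).1
    rw [Real.cos_two_mul'] at this
    linarith
  have hsc := Real.sin_sq_add_cos_sq a
  have hc2 : c ^ 2 = Real.sin a ^ 2 * Real.cos a ^ 2 := by rw [← sq_abs, hca]; ring
  have hfac : ∀ t, Real.pi ^ 2 * z₁ t ^ 2 * z t = -((z t - Real.sin a ^ 2) *
      (z t - Real.cos a ^ 2)) := fun t => by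
    have he := h.energy t
    have hpos := h.pos t
    have : c ^ 2 / z t * z t = c ^ 2 := by field_simp
    linear_combination z t * he - this - hc2 - z t * hsc
  have hbd : ∀ t, Real.sin a ^ 2 ≤ z t ∧ z t ≤ Real.cos a ^ 2 := fun t => by
    have h1 := hfac t
    have h2 : 0 ≤ Real.pi ^ 2 * z₁ t ^ 2 * z t := by have := h.pos t; positivity
    constructor <;> nlinarith
  refine ⟨?_, by rintro _ ⟨t, rfl⟩; exact (hbd t).1⟩
  have hcz : Continuous z := continuous_iff_continuousAt.mpr fun t => (h.hasDerivAt t).continuousAt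
  obtain ⟨x, -, hx⟩ := isCompact_Icc.exists_isMinOn (Set.nonempty_Icc.mpr hT.le) hcz.continuousOn
  have hmin : ∀ t, z x ≤ z t := fun t => by
    obtain ⟨y, hy, hty⟩ := hz.exists_mem_Ico₀ hT t
    rw [hty]
    exact hx ⟨hy.1, hy.2.le⟩
  have hz₁x : z₁ x = 0 :=
    IsLocalMin.hasDerivAt_eq_zero (Filter.Eventually.of_forall hmin) (h.hasDerivAt x)
  have h0 := hfac x
  rw [hz₁x] at h0
  have h1 : (z x - Real.sin a ^ 2) * (z x - Real.cos a ^ 2) = 0 := by linarith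
  rcases mul_eq_zero.mp h1 with h2 | h2
  · exact ⟨x, by linarith⟩
  -- A minimum equal to cos² a would make z constant. Then z₁' = 0 requires z² = c², which fails
  -- because sin² a < cos² a.
  · exfalso
    have hconst : z = fun _ => Real.cos a ^ 2 := funext fun t =>
      le_antisymm (hbd t).2 (by linarith [hmin t])
    have hz₁0 : z₁ = fun _ => 0 := funext fun t => by
      have := h.hasDerivAt t
      rw [hconst] at this
      exact this.unique (hasDerivAt_const t _)
    have h3 := h.hasDerivAt' x
    rw [hz₁0, hconst] at h3
    have h4 := h3.unique (hasDerivAt_const x 0)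
    have h5 : 0 < Real.cos a ^ 2 := by linarith [sq_nonneg (Real.sin a)]
    rw [hc2] at h4
    field_simp at h4
    linarith [(div_lt_one h5).mpr hlt]

/-! ### Clairaut constants at the minima, and the duality for closed geodesics -/

/-- At the minimum of ν the velocity term of the energy vanishes, leaving c² = z(1 - z) with z =
sin² a. -/
lemma IsOtsukiGeodesic.clairaut_sq {p q : ℕ} {a c : ℝ} {nu lam : ℝ → ℝ}
    (h : IsOtsukiGeodesic p q a nu lam)
    (hsys : ToricSystem c (fun t => Real.sin (nu t) ^ 2)
      (fun t => 2 * Real.sin (nu t) * Real.cos (nu t) * deriv nu t) lam) :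
    c ^ 2 = Real.sin a ^ 2 * Real.cos a ^ 2 := by
  obtain ⟨⟨t, ht⟩, hmin⟩ := h.isLeast
  have hd : deriv nu t = 0 := IsLocalMin.deriv_eq_zero
    (Filter.Eventually.of_forall fun s => by rw [ht]; exact hmin ⟨s, rfl⟩)
  have he := hsys.energy t
  have hpos := hsys.pos t
  beta_reduce at he hpos
  rw [hd, ht] at he
  rw [ht] at hpos
  have hs : Real.sin a ≠ 0 := fun e => by rw [e] at hpos; norm_num at hpos
  field_simp at he
  have := Real.sin_sq_add_cos_sq a
  linear_combination he - Real.sin a ^ 2 * this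

/-- At the minimum of φ the energy equation reduces to (1 - sin² b)² = k². -/
lemma DualSystem.cos_pow_four_of_isLeast {k b : ℝ} {phi y₁ theta : ℝ → ℝ}
    (h : DualSystem k (fun t => Real.sin (phi t)) y₁ theta) (hphi : Differentiable ℝ phi)
    (hb : IsLeast (Set.range phi) b)
    (hpos : ∀ t, 0 < Real.cos (phi t)) : Real.cos b ^ 4 = k ^ 2 := by
  obtain ⟨⟨t, ht⟩, hmin⟩ := hb
  have hd : deriv phi t = 0 := IsLocalMin.deriv_eq_zero
    (Filter.Eventually.of_forall fun s => by rw [ht]; exact hmin ⟨s, rfl⟩)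
  have h1 : y₁ t = 0 := by
    rw [(h.hasDerivAt t).unique (hphi t).hasDerivAt.sin, hd, mul_zero]
  have he := h.energy t
  have hc := hpos t
  rw [h1, ← Real.cos_sq'] at he
  rw [ht] at he hc
  field_simp at he
  linear_combination -he

theorem IsOtsukiGeodesic.exists_dual {p q : ℕ} {a : ℝ} {nu lam : ℝ → ℝ}
    {I' : ℝ → ℝ → EuclideanSpace ℝ (Fin 4)} (h : IsOtsukiGeodesic p q a nu lam)
    (hI : IsUnitNormal (rotationTorus nu lam) I') :
    ∃ (phi theta : ℝ → ℝ), IsClosedGeodesic phi theta ∧ (∃ t, phi t ≠ 0) ∧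
      SameImmersion nu lam I' phi theta ∧
      ∀ b, IsLeast (Set.range phi) b → Real.cos b ^ 4 = 4 * Real.sin a ^ 2 * Real.cos a ^ 2 := by
  obtain ⟨c, hsys⟩ := h.geodesic.toricSystem h.nu_mem
  have hc2 := h.clairaut_sq hsys
  have ha := h.a_mem
  have hsa : 0 < Real.sin a := Real.sin_pos_of_pos_of_lt_pi ha.1 (by linarith [ha.2, Real.pi_pos])
  have hca : 0 < Real.cos a := Real.cos_pos_of_mem_Ioo
    ⟨by linarith [ha.1, Real.pi_pos], by linarith [ha.2, Real.pi_pos]⟩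
  have hc : c ≠ 0 := by
    rintro rfl
    have : 0 < Real.sin a ^ 2 * Real.cos a ^ 2 := by positivity
    linarith
  obtain ⟨phi, theta, y₁, hcl, hsame, hdual⟩ :=
    exists_dual_geodesic h.nu_mem h.geodesic h.closed hc hsys hI
  refine ⟨phi, theta, hcl, ?_, hsame, fun b hb => ?_⟩
  -- On the equator the energy equation would give 4c² = 1, that is sin 2a = ±1, impossible for a <
  -- π/4.
  · by_contra hno
    push Not at hno
    have hy : y₁ 0 = 0 := by
      have := hdual.hasDerivAt 0
      simp only [hno, Real.sin_zero] at this
      exact this.unique (hasDerivAt_const 0 0)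
    have he := hdual.energy 0
    simp only [hno, hy, Real.sin_zero] at he
    have h2 := (cos_two_mul_mem ha).1
    rw [Real.cos_two_mul'] at h2
    have := Real.sin_sq_add_cos_sq a
    nlinarith
  · rw [hdual.cos_pow_four_of_isLeast (hcl.geodesic.smooth_u.differentiable (by simp)) hb
      fun t => Real.cos_pos_of_mem_Ioo (hcl.phi_mem t)]
    linear_combination 4 * hc2

theorem IsClosedGeodesic.exists_otsuki {phi theta : ℝ → ℝ} (h : IsClosedGeodesic phi theta)
    (hne : ∃ t, phi t ≠ 0) :
    ∃ (p q : ℕ) (a : ℝ) (nu lam : ℝ → ℝ) (I' : ℝ → ℝ → EuclideanSpace ℝ (Fin 4)),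
      IsOtsukiGeodesic p q a nu lam ∧ IsUnitNormal (rotationTorus nu lam) I' ∧
      SameImmersion nu lam I' phi theta := by
  have hp := Real.pi_pos
  obtain ⟨k, hsys⟩ := h.geodesic.dualSystem h.phi_mem
  obtain ⟨T, hT, m, hTm⟩ := h.closed
  have hcosphi : ∀ t, 0 < Real.cos (phi t) := fun t => Real.cos_pos_of_mem_Ioo (h.phi_mem t)
  have hsphi : ContDiff ℝ ∞ phi := h.geodesic.smooth_u
  have hstheta : ContDiff ℝ ∞ theta := h.geodesic.smooth_v
  have hsphi' : ContDiff ℝ ∞ (deriv phi) := (contDiff_infty_iff_deriv.mp hsphi).2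
  have hsy : ContDiff ℝ ∞ (fun t => Real.sin (phi t)) := hsphi.sin
  have hsy₁ : ContDiff ℝ ∞ (fun t => Real.cos (phi t) * deriv phi t) := hsphi.cos.mul hsphi'
  have hper : ∀ t, deriv phi (t + T) = deriv phi t := fun t => by
    rw [← deriv_comp_add_const]
    congr 1
    funext s
    exact (hTm s).1
  -- Off the equator (1 - y²)² < 1, and the energy equation gives k² ≤ (1 - y²)².
  have hk1 : k ^ 2 < 1 := by
    obtain ⟨t, ht⟩ := hne
    have hs : Real.sin (phi t) ≠ 0 := fun e => ht <| by
      obtain ⟨h1, h2⟩ := h.phi_mem t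
      exact (Real.sin_eq_zero_iff_of_lt_of_lt (by linarith) (by linarith)).mp e
    have h1 := hsys.energy t
    have h2 := hsys.sq_lt_one t
    beta_reduce at h1 h2
    have h3 : k ^ 2 / (1 - Real.sin (phi t) ^ 2) ^ 2 ≤ 1 := by
      have : 0 ≤ 4 * Real.pi ^ 2 * (Real.cos (phi t) * deriv phi t) ^ 2 := by positivity
      linarith
    have h4 : 0 < 1 - Real.sin (phi t) ^ 2 := by linarith
    rw [div_le_one (by positivity)] at h3
    have h5 : 0 < Real.sin (phi t) ^ 2 := by positivity
    nlinarith
  generalize hy : (fun t => Real.sin (phi t)) = y at hsys hsy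
  generalize hy₁ : (fun t => Real.cos (phi t) * deriv phi t) = y₁ at hsys hsy₁
  have hyT : ∀ t, y (t + T) = y t := fun t => by simp only [← hy, (hTm t).1]
  have hy₁T : ∀ t, y₁ (t + T) = y₁ t := fun t => by simp only [← hy₁, (hTm t).1, hper]
  -- For k = 0 the energy makes |y₁| = 1/(2π) everywhere, while Rolle's theorem on one period gives
  -- a zero of y₁: meridians do not close up.
  have hk : k ≠ 0 := by
    rintro rfl
    obtain ⟨x, -, hx⟩ := exists_deriv_eq_zero hT hsy.continuous.continuousOn
      (by rw [← hyT 0, zero_add])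
    have := hsys.energy x
    rw [← (hsys.hasDerivAt x).deriv, hx] at this
    norm_num at this
  -- The inverse of t = 2s + 2πy, which is the time change of the other direction for ε = 1.
  obtain ⟨σ, hσ⟩ : ∃ σ : ℝ → ℝ, σ = fun t => (t - 2 * Real.pi * y t) / 2 := ⟨_, rfl⟩
  have hσd : ∀ t, HasDerivAt σ ((1 - 2 * Real.pi * y₁ t) / 2) t := fun t => by
    rw [hσ]
    exact ((hasDerivAt_id t).sub ((hsys.hasDerivAt t).const_mul (2 * Real.pi))).div_const 2
  have hσs : ContDiff ℝ ∞ σ := by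
    rw [hσ]; exact (contDiff_id.sub (contDiff_const.mul hsy)).div_const 2
  have hσpos : ∀ t, 0 < (1 - 2 * Real.pi * y₁ t) / 2 := fun t => by
    linarith [(hsys.one_sub_pos hk t).1]
  have hbound : ∀ t, |σ t - 1 / 2 * t| ≤ Real.pi := fun t => by
    have h4 : |y t| ≤ 1 := by
      rw [← sq_le_one_iff_abs_le_one]; exact (hsys.sq_lt_one t).le
    have : σ t - 1 / 2 * t = -(Real.pi * y t) := by rw [hσ]; ring
    rw [this, abs_neg, abs_mul, abs_of_pos hp]
    nlinarith
  have hσsurj := surjective_of_abs_sub_mul_le hσs.continuous one_half_pos hbound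
  obtain ⟨ρ, hρs, hρσ, hσρ, hρd⟩ := exists_smooth_inverse hσs hσd hσpos hσsurj
  have hρT : ∀ s, ρ (s + T / 2) = ρ s + T := fun s => by
    have : σ (ρ s + T) = s + T / 2 := by
      rw [← hσρ s, hρσ, hσ]
      simp only [hyT]
      ring
    rw [← this, hρσ]
  obtain ⟨δ, hδ, hδc⟩ := exists_sign_mul_abs (c := -k / 2) (ε := 1) (Or.inl rfl)
  have htor := hsys.toricSystem (η := δ * (Real.pi / 2)) hk hρd
  obtain ⟨z, hz⟩ : ∃ z : ℝ → ℝ,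
    z = fun s => (1 - y (ρ s) ^ 2) * (1 - 2 * Real.pi * y₁ (ρ s)) / 2 := ⟨_, rfl⟩
  obtain ⟨lam, hlam⟩ : ∃ lam : ℝ → ℝ, lam = fun s => δ * (Real.pi / 2) - theta (ρ s) -
    Real.arctan ((1 - y (ρ s) ^ 2) * (1 - 2 * Real.pi * y₁ (ρ s)) / 2 * y (ρ s) / (-k / 2)) :=
    ⟨_, rfl⟩
  rw [← hz, ← hlam] at htor
  have hsz : ContDiff ℝ ∞ z := by
    rw [hz]
    exact ((contDiff_const.sub ((hsy.comp hρs).pow 2)).mul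
      (contDiff_const.sub (contDiff_const.mul (hsy₁.comp hρs)))).div_const 2
  have hslam : ContDiff ℝ ∞ lam := by
    rw [hlam]
    refine (contDiff_const.sub (hstheta.comp hρs)).sub (Real.contDiff_arctan.comp ?_)
    exact ((((contDiff_const.sub ((hsy.comp hρs).pow 2)).mul
      (contDiff_const.sub (contDiff_const.mul (hsy₁.comp hρs)))).div_const 2).mul
        (hsy.comp hρs)).div_const _
  have hzT : ∀ s, z (s + T / 2) = z s := fun s => by simp only [hz, hρT, hyT, hy₁T]
  have hlamT : ∀ s, lam (s + T / 2) = lam s + 2 * Real.pi * (-m : ℤ) := fun s => by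
    simp only [hlam, hρT, hyT, hy₁T, (hTm _).2]
    push_cast
    ring
  have hk0 : 0 < |k| := abs_pos.mpr hk
  have hk1' : |k| < 1 := (sq_lt_one_iff_abs_lt_one k).mp hk1
  -- Chosen so that sin 2a = |k|, which is |c| = sin a cos a for c = -k/2.
  obtain ⟨a, had⟩ : ∃ a, a = Real.arcsin |k| / 2 := ⟨_, rfl⟩
  have ha : a ∈ Set.Ioo 0 (Real.pi / 4) := by
    have h1 := Real.arcsin_pos.mpr hk0
    have h2 := Real.arcsin_lt_pi_div_two.mpr hk1'
    constructor <;> linarith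
  have hca : |-k / 2| = Real.sin a * Real.cos a := by
    have : Real.sin (2 * a) = |k| := by
      rw [had, mul_div_cancel₀ _ two_ne_zero, Real.sin_arcsin (by linarith) hk1'.le]
    rw [Real.sin_two_mul] at this
    rw [abs_div, abs_neg, abs_two, ← this]
    ring
  have hsqz0 : ∀ s, 0 < Real.sqrt (z s) := fun s => Real.sqrt_pos.mpr (htor.pos s)
  have hsqz1 : ∀ s, Real.sqrt (z s) ^ 2 < 1 := fun s => by
    rw [Real.sq_sqrt (htor.pos s).le]; exact htor.lt_one s
  obtain ⟨nu, hnu⟩ : ∃ nu : ℝ → ℝ, nu = fun s => Real.arcsin (Real.sqrt (z s)) := ⟨_, rfl⟩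
  have hnumem : ∀ s, nu s ∈ Set.Ioo 0 (Real.pi / 2) := fun s => by
    rw [hnu]; exact ⟨Real.arcsin_pos.mpr (hsqz0 s), (arcsin_mem_Ioo (hsqz1 s)).2⟩
  have hsnu : ContDiff ℝ ∞ nu := by
    rw [hnu]; exact ContDiff.arcsin' (hsz.sqrt fun s => (htor.pos s).ne') hsqz1
  have hznu : ∀ s, z s = Real.sin (nu s) ^ 2 := fun s => by
    rw [hnu]
    simp only
    rw [sin_arcsin_of_sq_lt_one (hsqz1 s), Real.sq_sqrt (htor.pos s).le]
  have hgeo := htor.isUnitSpeedGeodesic hnumem hznu hsnu hslam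
  have hz₁ : ∀ s, y (ρ s) / Real.pi = 2 * Real.sin (nu s) * Real.cos (nu s) * deriv nu s :=
    fun s => by
      have h1 := (hgeo.hasDerivAt_u s).sin.pow 2
      have h2 := htor.hasDerivAt s
      rw [show z = fun s => Real.sin (nu s) ^ 2 from funext hznu] at h2
      rw [h2.unique h1]
      push_cast
      ring
  have hleast := htor.isLeast ha hca (half_pos hT) hzT
  have hT2 := hρT 0
  obtain ⟨P, Q, hQ, hΩ⟩ := htor.exists_Omega_eq (m := -m) ha hca (half_pos hT)
    (by simpa using hzT 0) (by
      rw [show ρ (T / 2) = ρ 0 + T by rw [← hT2, zero_add], hyT])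
    (by simpa using hlamT 0)
  have hmem := Omega_mem ha
  -- The fraction from the winding numbers need not be reduced.
  obtain ⟨p, q, hpq, hP', hQ'⟩ := Nat.exists_coprime P Q
  have hg : 0 < P.gcd Q := Nat.gcd_pos_of_pos_right _ hQ
  have hq : 0 < q := by
    rcases Nat.eq_zero_or_pos q with h0 | h0
    · rw [h0, zero_mul] at hQ'; omega
    · exact h0
  have hratio : (P : ℝ) / Q = (p : ℝ) / q := by
    have hg' : ((P.gcd Q : ℕ) : ℝ) ≠ 0 := by exact_mod_cast hg.ne'
    have e1 : (P : ℝ) = p * (P.gcd Q : ℕ) := by exact_mod_cast hP'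
    have e2 : (Q : ℝ) = q * (P.gcd Q : ℕ) := by exact_mod_cast hQ'
    rw [e1, e2, mul_div_mul_right _ _ hg']
  rw [hratio] at hΩ
  rw [hΩ] at hmem
  have hlow : (1 : ℝ) / 2 < (p : ℝ) / q := by
    refine lt_of_mul_lt_mul_right ?_ hp.le
    linarith [hmem.1]
  have hup : (p : ℝ) / q < Real.sqrt 2 / 2 := lt_of_mul_lt_mul_right hmem.2 hp.le
  refine ⟨p, q, a, nu, lam, torusNormal nu lam, ⟨?_, hq, hpq, hlow, hup, ha, hnumem, hgeo,
    ⟨T / 2, half_pos hT, -m, fun s => ⟨by simp only [hnu, hzT], hlamT s⟩⟩, ?_, hΩ⟩,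
    isUnitNormal_torusNormal hgeo, σ, hσs, fun t => by rw [(hσd t).deriv]; exact hσpos t,
    hσsurj, fun α t => ?_⟩
  · rcases Nat.eq_zero_or_pos p with h0 | h0
    · rw [h0] at hlow; norm_num at hlow
    · exact h0
  · have hsa : 0 ≤ Real.sin a := (Real.sin_pos_of_pos_of_lt_pi ha.1 (by linarith [ha.2])).le
    have harc : Real.arcsin (Real.sqrt (Real.sin a ^ 2)) = a := by
      rw [Real.sqrt_sq hsa, Real.arcsin_sin (by linarith [ha.1]) (by linarith [ha.2])]
    obtain ⟨⟨s, hs⟩, hmin⟩ := hleast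
    refine ⟨⟨s, by rw [hnu]; simp only; rw [hs, harc]⟩, ?_⟩
    rintro _ ⟨s', rfl⟩
    rw [hnu, ← harc]
    exact Real.monotone_arcsin (Real.sqrt_le_sqrt (hmin ⟨s', rfl⟩))
  · have key := wedge_torusNormal_eq (φ := phi t) (θ := theta t) (s := σ t) (ε := 1) hnumem hgeo
      (c := -k / 2) (div_ne_zero (neg_ne_zero.mpr hk) two_ne_zero)
      (by rw [(htor.hasDerivAt_angle (σ t)).deriv, hznu]) (Or.inl rfl) hδ hδc (hcosphi t)
      (by rw [← hz₁, hρσ, ← hy]; field_simp) ?_ α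
    · rw [one_smul] at key
      exact key
    · rw [← hz₁, ← hznu, hlam, hz]
      simp only [hρσ]
      rw [show Real.pi * ((1 - y t ^ 2) * (1 - 2 * Real.pi * y₁ t) / 2) * (y t / Real.pi)
        = (1 - y t ^ 2) * (1 - 2 * Real.pi * y₁ t) / 2 * y t by field_simp]
      ring

end Otsuki

/-! ### Assembly of the statement -/

theorem proposition3 :
    -- the two sets of surfaces in the sphere coincide
    {S : Set (EuclideanSpace ℝ (Fin 5)) | ∃ p q : ℕ, Otsuki.IsBipolarOtsukiSurface p q S}
      = {S : Set (EuclideanSpace ℝ (Fin 5)) | ∃ phi theta : ℝ → ℝ,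
          Otsuki.IsClosedGeodesic phi theta ∧ (∃ t, phi t ≠ 0) ∧
          S = Otsuki.orbitSurface phi theta} ∧
    -- the preimages of closed geodesics are minimal surfaces
    (∀ phi theta : ℝ → ℝ, Otsuki.IsClosedGeodesic phi theta →
      Otsuki.IsMinimalImmersionInSphere (Otsuki.orbitImmersion phi theta) ∧
      Set.range (fun z : ℝ × ℝ => Otsuki.orbitImmersion phi theta z.1 z.2)
        = Otsuki.orbitSurface phi theta) ∧
    -- the surfaces also coincide as immersed surfaces
    (∀ (p q : ℕ) (a : ℝ) (nu lam : ℝ → ℝ) (I' : ℝ → ℝ → EuclideanSpace ℝ (Fin 4)),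
      Otsuki.IsOtsukiGeodesic p q a nu lam →
      Otsuki.IsUnitNormal (Otsuki.rotationTorus nu lam) I' →
      ∃ phi theta : ℝ → ℝ, Otsuki.IsClosedGeodesic phi theta ∧ (∃ t, phi t ≠ 0) ∧
        Otsuki.SameImmersion nu lam I' phi theta) ∧
    (∀ phi theta : ℝ → ℝ, Otsuki.IsClosedGeodesic phi theta → (∃ t, phi t ≠ 0) →
      ∃ (p q : ℕ) (a : ℝ) (nu lam : ℝ → ℝ) (I' : ℝ → ℝ → EuclideanSpace ℝ (Fin 4)),
        Otsuki.IsOtsukiGeodesic p q a nu lam ∧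
        Otsuki.IsUnitNormal (Otsuki.rotationTorus nu lam) I' ∧
        Otsuki.SameImmersion nu lam I' phi theta) ∧
    -- the relation between the parameters of corresponding geodesics
    (∀ (p q : ℕ) (a b : ℝ) (nu lam phi theta : ℝ → ℝ)
      (I' : ℝ → ℝ → EuclideanSpace ℝ (Fin 4)),
      Otsuki.IsOtsukiGeodesic p q a nu lam →
      Otsuki.IsUnitNormal (Otsuki.rotationTorus nu lam) I' →
      Otsuki.IsClosedGeodesic phi theta →
      IsLeast (Set.range phi) b →
      Otsuki.equator '' Otsuki.orbitSurface phi theta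
        = Set.range (fun z : ℝ × ℝ =>
            Otsuki.wedge (Otsuki.rotationTorus nu lam z.1 z.2) (I' z.1 z.2)) →
      Real.cos b ^ 4 = 4 * Real.sin a ^ 2 * Real.cos a ^ 2) := by
  refine ⟨?_, fun phi theta h => ⟨h.isMinimalImmersionInSphere, h.range_orbitImmersion⟩,
    fun p q a nu lam I' h hI => ?_, fun phi theta h hne => h.exists_otsuki hne,
    fun p q a b nu lam phi theta I' h hI hg hb heq => ?_⟩
  · ext S
    constructor
    · rintro ⟨p, q, a, nu, lam, I', h, hI, hS⟩
      obtain ⟨phi, theta, hcl, hne, hsame, -⟩ := h.exists_dual hI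
      refine ⟨phi, theta, hcl, hne, ?_⟩
      rw [hsame.range_eq, hcl.range_orbitImmersion] at hS
      exact Otsuki.equator_injective.image_injective hS
    · rintro ⟨phi, theta, hcl, hne, rfl⟩
      obtain ⟨p, q, a, nu, lam, I', h, hI, hsame⟩ := hcl.exists_otsuki hne
      refine ⟨p, q, a, nu, lam, I', h, hI, ?_⟩
      rw [hsame.range_eq, hcl.range_orbitImmersion]
  · obtain ⟨phi, theta, hcl, hne, hsame, -⟩ := h.exists_dual hI
    exact ⟨phi, theta, hcl, hne, hsame⟩
  · obtain ⟨phi₀, theta₀, hcl, -, hsame, hmin⟩ := h.exists_dual hI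
    rw [hsame.range_eq] at heq
    have hsets := Otsuki.equator_injective.image_injective heq
    rw [← hg.range_orbitImmersion] at hsets
    -- The surfaces agree only as sets, so the geodesics are compared through the last coordinate
    -- sin φ, which is constant on orbits: the set determines the range of φ, hence its minimum.
    have hle : ∀ {f g : ℝ → ℝ} {f' g' : ℝ → ℝ}, Otsuki.IsClosedGeodesic f f' →
        Otsuki.IsClosedGeodesic g g' →
        Set.range (fun z : ℝ × ℝ => Otsuki.orbitImmersion f f' z.1 z.2)
          ⊆ Set.range (fun z : ℝ × ℝ => Otsuki.orbitImmersion g g' z.1 z.2) →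
        Set.range f ⊆ Set.range g := by
      rintro f g f' g' hf hg hsub _ ⟨t, rfl⟩
      obtain ⟨⟨β, s⟩, hs⟩ := hsub ⟨(0, t), rfl⟩
      have h4 : Real.sin (g s) = Real.sin (f t) :=
        congrArg (fun v : EuclideanSpace ℝ (Fin 5) => v 4) hs
      exact ⟨s, Real.injOn_sin ⟨(hg.phi_mem s).1.le, (hg.phi_mem s).2.le⟩
        ⟨(hf.phi_mem t).1.le, (hf.phi_mem t).2.le⟩ h4⟩
    have hrange : Set.range phi = Set.range phi₀ :=
      (hle hg hcl hsets.subset).antisymm (hle hcl hg hsets.symm.subset)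
    exact hmin b (hrange ▸ hb)
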